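/- Let $\Omega\subset\mathbb{R}^2$ be a compact set with non-empty interior whose boundary is a finite union of straight line segments, and let $Y_1,\dots,Y_K\in\Omega$ ($K\ge 1$) be distinct points. Let $S(X)=\min_k\|X-Y_k\|$ be the distance transform, let $V_k=\{X\in\Omega:\|X-Y_k\|\le\|X-Y_j\|\text{ for all }j\}$ be the $k$-th Voronoi region, and assume that each $V_k$ is star-shaped with respect to $Y_k$ (for instance, that each $V_k$ is convex, as is the case when $\Omega$ is convex). Write $e(\theta)=(\cos\theta,\sin\theta)$, let $R_k(\theta)=\max\{r\ge 0: Y_k+r\,e(\theta)\in V_k\}$ be the length of the ray of $V_k$ from $Y_k$ in the direction $\theta$, let $L$ be the area of $\Omega$, and put $$P(\omega)=\frac1L\sum_{k=1}^K\frac{R_k(\omega)^2}{2}.$$ For $0<\epsilon<\frac12$ let $$\Omega^\epsilon=\bigcup_{k=1}^K\{Y_k+r\,e(\theta):\theta\in[0,2\pi),\ \epsilon R_k(\theta)\le r\le(1-\epsilon)R_k(\theta)\},$$ let $L^\epsilon$ be its area, and for $\tau\neq0$ let $$F^\epsilon_\tau(u,v)=\frac{1}{2\pi\tau\sqrt{L^\epsilon}}\iint_{\Omega^\epsilon}\exp\Big(\frac{iS(x,y)}{\tau}\Big)\exp\Big(\frac{-i(ux+vy)}{\tau}\Big)\,dx\,dy,\qquad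 P^\epsilon_\tau(\tilde r,\omega)=\big|F^\epsilon_\tau(\tilde r\cos\omega,\tilde r\sin\omega)\big|^2 .$$ Then for all $0<\epsilon<\frac12$, $0<\delta<1$, $\omega_0\in\mathbb{R}$ and $0<\Delta<2\pi$, $$\lim_{\tau\to0}\int_{\omega_0}^{\omega_0+\Delta}\int_{1-\delta}^{1+\delta}P^\epsilon_\tau(\tilde r,\omega)\,\tilde r\,d\tilde r\,d\omega=\int_{\omega_0}^{\omega_0+\Delta}P(\omega)\,d\omega .$$ Here $P$ is the density of the orientations of the gradients of the distance transform: it is integrable on $[\omega_0,\omega_0+\Delta]$, and $\int_{\omega_0}^{\omega_0+\Delta}P(\omega)\,d\omega$ is the probability that at a uniformly distributed random point $X$ of $\Omega$ the function $S$ is differentiable with $\nabla S(X)=e(\theta)$ for some $\theta\in[\omega_0,\omega_0+\Delta]$. -/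

import Mathlib

open MeasureTheory Filter Topology

namespace DistTransform

/-- The Euclidean plane. -/
abbrev Plane : Type := EuclideanSpace ℝ (Fin 2)

/-- The unit vector of orientation `θ`. -/
noncomputable def dir (θ : ℝ) : Plane := !₂[Real.cos θ, Real.sin θ]

/-- The boundary of `Ω` consists of finitely many straight line segments. -/
def HasPolygonalBoundary (Ω : Set Plane) : Prop :=
  ∃ s : Finset (Plane × Plane), frontier Ω = ⋃ q ∈ s, segment ℝ q.1 q.2

/-- The distance transform `S(X) = min_k ‖X - Y_k‖` of the point set `Y_1, …, Y_K`. -/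
noncomputable def S {K : ℕ} (Y : Fin K → Plane) (X : Plane) : ℝ := ⨅ k, ‖X - Y k‖

/-- The part of the Voronoi cell of `Y_k` that lies in `Ω` (not translated to the origin). -/
def cell {K : ℕ} (Ω : Set Plane) (Y : Fin K → Plane) (k : Fin K) : Set Plane :=
  {X | X ∈ Ω ∧ ∀ j, ‖X - Y k‖ ≤ ‖X - Y j‖}

/-- `R_k(θ)`, the length of the ray of the `k`-th cell that starts at `Y_k` with orientation `θ`. -/
noncomputable def R {K : ℕ} (Ω : Set Plane) (Y : Fin K → Plane) (k : Fin K) (θ : ℝ) : ℝ :=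
  sSup {r : ℝ | 0 ≤ r ∧ Y k + r • dir θ ∈ cell Ω Y k}

/-- `Ω^ε`, the union over `k` of the points `Y_k + r (cos θ, sin θ)` with
`θ ∈ [0, 2π)` and `ε R_k(θ) ≤ r ≤ (1 - ε) R_k(θ)`. -/
def truncated {K : ℕ} (Ω : Set Plane) (Y : Fin K → Plane) (ε : ℝ) : Set Plane :=
  ⋃ k, {X | ∃ θ ∈ Set.Ico 0 (2 * Real.pi), ∃ r ∈ Set.Icc (ε * R Ω Y k θ) ((1 - ε) * R Ω Y k θ),
    X = Y k + r • dir θ}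

/-- `F_τ^ε(u, v)`, the normalized Fourier transform of `exp (i S / τ)` on `Ω^ε`; the normalization
is `1 / (2 π τ l)` with `l` the square root of the area of `Ω^ε`. -/
noncomputable def F {K : ℕ} (Ω : Set Plane) (Y : Fin K → Plane) (ε τ u v : ℝ) : ℂ :=
  ((1 / (2 * Real.pi * τ * Real.sqrt (volume.real (truncated Ω Y ε))) : ℝ) : ℂ) *
    ∫ X in truncated Ω Y ε,
      Complex.exp (Complex.I * (S Y X : ℂ) / (τ : ℂ)) *
        Complex.exp (-(Complex.I * ((u * X 0 + v * X 1 : ℝ) : ℂ)) / (τ : ℂ))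

/-- The power spectrum `P_τ^ε(r, ω) = |F_τ^ε|²` in polar coordinates. -/
noncomputable def powerSpectrum {K : ℕ} (Ω : Set Plane) (Y : Fin K → Plane) (ε τ r ω : ℝ) : ℝ :=
  ‖F Ω Y ε τ (r * Real.cos ω) (r * Real.sin ω)‖ ^ 2

/-- `P(ω) = (1 / L) ∑_k R_k(ω)² / 2`, with `L` the area of `Ω`. -/
noncomputable def P {K : ℕ} (Ω : Set Plane) (Y : Fin K → Plane) (ω : ℝ) : ℝ :=
  (1 / volume.real Ω) * ∑ k, R Ω Y k ω ^ 2 / 2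

/-- The probability that a uniformly distributed point of `Ω` is one at which `S` is differentiable
with gradient `(cos θ, sin θ)` for some `θ ∈ [a, b]`. -/
noncomputable def orientationProb {K : ℕ} (Ω : Set Plane) (Y : Fin K → Plane) (a b : ℝ) : ℝ :=
  (1 / volume.real Ω) *
    volume.real {X | X ∈ Ω ∧ ∃ θ ∈ Set.Icc a b, HasGradientAt (S Y) (dir θ) X}

end DistTransform

/-! No stationary phase is needed: the power spectrum is treated as a probability measure and its
characteristic function is computed. Let `A` be an open set of finite positive area and `s` a phase
differentiable almost everywhere on `A`. In the rescaled frequency `u = 2πτw`, the normalized power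
spectrum of `1_A exp(is/τ)` is a probability measure. By Plancherel its characteristic function at
`t` is the normalized autocorrelation of the wave at displacement `τt` (`charFun_spectralMeasure`).
The integrand there is `exp(i(s(x+τt)-s(x))/τ)`, which tends to `exp(i⟨∇s(x),t⟩)`. Dominated
convergence then gives the characteristic function of the law of `∇s` at a uniform point of `A`.
Lévy's continuity theorem and the portmanteau theorem turn this into convergence on every set whose
frontier is null for that law (`tendsto_spectralMeasure`).

This is applied to `S` on the interior of `Ω^ε` and to an annular sector around the unit circle.
Almost everywhere `∇S` is the unit vector pointing away from the nearest centre. The frontier of the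
sector meets the unit circle only in its two end directions, and these have probability zero. Since
`∇S` is constant along the rays of each cell, the event that `∇S` lies in the sector is a union of
sectors of cells, of area `∑ ∫ R_k²/2` (`volume_inter_sector`). Truncation keeps the same fraction
`(1-ε)² - ε² = 1-2ε` of every cone (`volume_shell_inter_cone`), so the limit does not depend on `ε`.
-/

open MeasureTheory Filter Topology

/-! ### Plancherel's theorem and autocorrelation. -/

section Plancherel

open FourierTransform SchwartzMap ComplexInnerProductSpace

variable {E : Type*} [NormedAddCommGroup E] [InnerProductSpace ℝ E] [FiniteDimensional ℝ E]
  [MeasurableSpace E] [BorelSpace E]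

/-- The Fourier transform of an integrable and square integrable function, as an integral, agrees
with the Fourier transform on `L²`. -/
theorem fourier_toLp_ae_eq {f : E → ℂ} (hf : Integrable f) (hf2 : MemLp f 2) :
    (𝓕 (hf2.toLp f) : Lp ℂ 2 (volume : Measure E)) =ᵐ[volume] 𝓕 f := by
  have hcont : Continuous (𝓕 f) :=
    VectorFourier.fourierIntegral_continuous Real.continuous_fourierChar
      (by exact continuous_inner) hf
  refine ae_eq_of_integral_contDiff_smul_eq
    ((Lp.memLp _).locallyIntegrable (by norm_num)) hcont.locallyIntegrable ?_
  intro g hg hgs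
  -- Both transforms are tested against the same smooth compactly supported function. The `L²`
  -- transform moves onto it by the definition for tempered distributions, the integral transform by
  -- Fubini.
  let gs : 𝓢(E, ℂ) := (hgs.comp_left (g := ((↑) : ℝ → ℂ)) (by simp)).toSchwartzMap
      (Complex.ofRealCLM.contDiff.comp hg)
  have h1 := congrArg (fun T : 𝓢'(E, ℂ) => T gs)
    (Lp.fourier_toTemperedDistribution_eq (hf2.toLp f))
  simp only [TemperedDistribution.fourier_apply, Lp.toTemperedDistribution_apply] at h1
  have h2 : ∫ x, 𝓕 gs x • (hf2.toLp f) x = ∫ x, 𝓕 (gs : E → ℂ) x • f x := by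
    refine integral_congr_ae ?_
    filter_upwards [hf2.coeFn_toLp] with x hx
    rw [hx, SchwartzMap.fourier_coe]
  have h3 := VectorFourier.integral_fourierIntegral_smul_eq_flip (L := innerₗ E)
    (μ := volume) (ν := volume) Real.continuous_fourierChar
    (by exact continuous_inner) (gs.integrable (μ := volume)) hf
  rw [flip_innerₗ] at h3
  calc ∫ x, g x • (𝓕 (hf2.toLp f) : Lp ℂ 2 (volume : Measure E)) x
      = ∫ x, gs x • (𝓕 (hf2.toLp f) : Lp ℂ 2 (volume : Measure E)) x := rfl
    _ = ∫ x, gs x • 𝓕 f x := by rw [← h1, h2]; exact h3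
    _ = ∫ x, g x • 𝓕 f x := rfl

/-- The Fourier transform of the autocorrelation of `f` is `‖𝓕 f‖²`, in integrated form. -/
theorem integral_fourierChar_mul_norm_fourier_sq {f : E → ℂ} (hf : Integrable f)
    (hf2 : MemLp f 2) (h : E) :
    ∫ w, Complex.exp (2 * Real.pi * Complex.I * (inner ℝ w h : ℝ)) * ((‖𝓕 f w‖ ^ 2 : ℝ) : ℂ) =
      ∫ x, f (x + h) * starRingEnd ℂ (f x) := by
  have hmp := measurePreserving_add_right (volume : Measure E) h
  have hg : Integrable (fun x => f (x + h)) := hf.comp_add_right h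
  have hg2 : MemLp (fun x => f (x + h)) 2 := hf2.comp_measurePreserving hmp
  have key := Lp.inner_fourier_eq (hf2.toLp f) (hg2.toLp _)
  rw [L2.inner_def, L2.inner_def] at key
  -- Plancherel is applied to `f` and its translate: translation by `h` becomes multiplication by a
  -- character, which is the exponential wanted on the left.
  have e1 : 𝓕 (fun x => f (x + h)) =
      fun w => Real.fourierChar (inner ℝ h w : ℝ) • 𝓕 f w :=
    VectorFourier.fourierIntegral_comp_add_right _ _ (innerₗ E) f h
  calc _ = ∫ w, inner ℂ ((𝓕 (hf2.toLp f) : Lp ℂ 2 (volume : Measure E)) w)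
            ((𝓕 (hg2.toLp _) : Lp ℂ 2 (volume : Measure E)) w) := by
        refine integral_congr_ae ?_
        filter_upwards [fourier_toLp_ae_eq hf hf2, fourier_toLp_ae_eq hg hg2] with w h1 h2
        rw [h1, h2, e1]
        simp only [Circle.smul_def, Real.fourierChar_apply, RCLike.inner_apply, smul_eq_mul]
        rw [Complex.ofReal_pow, ← Complex.mul_conj', real_inner_comm h w]
        push_cast
        rw [show 2 * (Real.pi : ℂ) * Complex.I * (inner ℝ h w : ℝ) =
          2 * Real.pi * (inner ℝ h w : ℝ) * Complex.I by ring]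
        ring
    _ = _ := key
    _ = _ := by
        refine integral_congr_ae ?_
        filter_upwards [hf2.coeFn_toLp, hg2.coeFn_toLp] with w h1 h2
        rw [h1, h2]
        rfl

end Plancherel

/-! ### Weak convergence of power spectra to the law of the gradient. -/

section Semiclassical

open FourierTransform

/-- The wave function `exp (i s / τ)` cut off outside `A`. -/
noncomputable def wave {E : Type*} (A : Set E) (s : E → ℝ) (τ : ℝ) : E → ℂ :=
  A.indicator fun x => Complex.exp (Complex.I * (s x : ℂ) / (τ : ℂ))

theorem norm_exp_phase (a τ : ℝ) : ‖Complex.exp (Complex.I * (a : ℂ) / (τ : ℂ))‖ = 1 := by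
  rw [show Complex.I * (a : ℂ) / (τ : ℂ) = ((a / τ : ℝ) : ℂ) * Complex.I by push_cast; ring]
  exact Complex.norm_exp_ofReal_mul_I _

theorem norm_wave_le {E : Type*} (A : Set E) (s : E → ℝ) (τ : ℝ) (x : E) : ‖wave A s τ x‖ ≤ 1 := by
  unfold wave
  by_cases hx : x ∈ A
  · rw [Set.indicator_of_mem hx, norm_exp_phase]
  · simp [hx]

theorem measurable_wave {E : Type*} [MeasurableSpace E] {A : Set E} (hA : MeasurableSet A) {s : E → ℝ} (hs : Measurable s)
    (τ : ℝ) : Measurable (wave A s τ) := by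
  unfold wave
  exact Measurable.indicator (by fun_prop) hA

variable {E : Type*} [NormedAddCommGroup E] [InnerProductSpace ℝ E] [FiniteDimensional ℝ E]
  [MeasurableSpace E] [BorelSpace E]

theorem integrable_wave {A : Set E} (hA : MeasurableSet A) (hfin : volume A ≠ ⊤) {s : E → ℝ}
    (hs : Measurable s) (τ : ℝ) : Integrable (wave A s τ) := by
  unfold wave
  rw [integrable_indicator_iff hA]
  refine Measure.integrableOn_of_bounded (M := 1) hfin (by fun_prop) ?_
  exact ae_of_all _ fun x => (norm_exp_phase _ _).le

theorem memLp_wave {A : Set E} (hA : MeasurableSet A) (hfin : volume A ≠ ⊤) {s : E → ℝ}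
    (hs : Measurable s) (τ : ℝ) : MemLp (wave A s τ) 2 := by
  unfold wave
  rw [memLp_indicator_iff_restrict hA]
  have : IsFiniteMeasure (volume.restrict A) := ⟨by simpa [lt_top_iff_ne_top] using hfin⟩
  exact MemLp.of_bound (by fun_prop) 1 (ae_of_all _ fun x => (norm_exp_phase _ _).le)

/-- The autocorrelation of the wave function at distance `τ t` converges, as `τ → 0`, to the
characteristic function of the gradients of the phase. -/
theorem tendsto_integral_wave_mul_conj {A : Set E} (hA : IsOpen A) (hfin : volume A ≠ ⊤)
    {s : E → ℝ} (hs : Measurable s) (hd : ∀ᵐ x, x ∈ A → DifferentiableAt ℝ s x) (t : E) :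
    Tendsto (fun τ : ℝ => ∫ x, wave A s τ (x + τ • t) * starRingEnd ℂ (wave A s τ x)) (𝓝[≠] 0)
      (𝓝 (∫ x in A, Complex.exp ((inner ℝ (gradient s x) t : ℝ) * Complex.I))) := by
  rw [← integral_indicator hA.measurableSet]
  refine tendsto_integral_filter_of_dominated_convergence (A.indicator fun _ => (1 : ℝ)) ?_ ?_ ?_ ?_
  · refine Eventually.of_forall fun τ => ?_
    have h1 := measurable_wave hA.measurableSet hs τ
    have h2 : Measurable fun x : E => x + τ • t := by fun_prop
    exact ((h1.comp h2).mul (Complex.continuous_conj.measurable.comp h1)).aestronglyMeasurable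
  · refine Eventually.of_forall fun τ => ae_of_all _ fun x => ?_
    by_cases hx : x ∈ A
    · rw [Set.indicator_of_mem hx, norm_mul, RCLike.norm_conj]
      exact mul_le_one₀ (norm_wave_le _ _ _ _) (norm_nonneg _) (norm_wave_le _ _ _ _)
    · simp [wave, hx]
  · exact (integrable_indicator_iff hA.measurableSet).2 (by simpa [lt_top_iff_ne_top] using hfin)
  · filter_upwards [hd] with x hx
    by_cases hxA : x ∈ A
    swap
    · simp [wave, hxA]
    rw [Set.indicator_of_mem hxA]
    have hlim : Tendsto (fun τ : ℝ => τ⁻¹ * (s (x + τ • t) - s x)) (𝓝[≠] 0)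
        (𝓝 (inner ℝ (gradient s x) t)) := by
      have h := ((hx hxA).hasGradientAt.hasFDerivAt.hasLineDerivAt t).tendsto_slope_zero
      simpa using h
    -- Openness of `A` enters here: for small `τ` the cut-off does not affect the translated factor.
    have hmem : ∀ᶠ τ : ℝ in 𝓝[≠] 0, x + τ • t ∈ A := by
      have hc : Tendsto (fun τ : ℝ => x + τ • t) (𝓝[≠] 0) (𝓝 x) := by
        have : Continuous fun τ : ℝ => x + τ • t := by fun_prop
        simpa using (this.tendsto 0).mono_left nhdsWithin_le_nhds
      exact hc (hA.mem_nhds hxA)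
    have h3 : Tendsto (fun τ : ℝ => Complex.exp (((τ⁻¹ * (s (x + τ • t) - s x) : ℝ) : ℂ) *
        Complex.I)) (𝓝[≠] 0) (𝓝 (Complex.exp ((inner ℝ (gradient s x) t : ℝ) * Complex.I))) := by
      have : Continuous fun a : ℝ => Complex.exp ((a : ℂ) * Complex.I) := by fun_prop
      exact (this.tendsto _).comp hlim
    refine h3.congr' ?_
    filter_upwards [hmem] with τ hτ
    rw [wave, Set.indicator_of_mem hτ, Set.indicator_of_mem hxA, ← Complex.exp_conj,
      ← Complex.exp_add]
    congr 1
    simp only [map_div₀, map_mul, Complex.conj_I, Complex.conj_ofReal]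
    push_cast
    ring

/-- The power spectrum of the wave function in the rescaled frequency `2 π τ w`, as a measure. -/
noncomputable def spectralMeasure (A : Set E) (s : E → ℝ) (τ : ℝ) : Measure E :=
  volume.withDensity fun u => ENNReal.ofReal
    (‖𝓕 (wave A s τ) ((2 * Real.pi * τ)⁻¹ • u)‖ ^ 2 /
      (|2 * Real.pi * τ| ^ Module.finrank ℝ E * volume.real A))

/-- With `u = 2πτw` the phase `⟨u, t⟩` becomes `2π⟨w, τt⟩`, a shift by `τt` in the Plancherel
identity. The Jacobian cancels the power of `|2πτ|` in the normalization. -/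
theorem charFun_spectralMeasure {A : Set E} (hA : MeasurableSet A) (hfin : volume A ≠ ⊤)
    {s : E → ℝ} (hs : Measurable s) {τ : ℝ} (hτ : τ ≠ 0) (t : E) :
    charFun (spectralMeasure A s τ) t =
      (volume.real A : ℂ)⁻¹ * ∫ x, wave A s τ (x + τ • t) * starRingEnd ℂ (wave A s τ x) := by
  have hi := integrable_wave hA hfin hs τ
  have hcont : Continuous (𝓕 (wave A s τ)) :=
    VectorFourier.fourierIntegral_continuous Real.continuous_fourierChar
      (by exact continuous_inner) hi
  have hc : 2 * Real.pi * τ ≠ 0 := by positivity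
  rw [charFun_apply, spectralMeasure, integral_withDensity_eq_integral_toReal_smul
    (by fun_prop) (by simp), ← integral_fourierChar_mul_norm_fourier_sq hi
    (memLp_wave hA hfin hs τ)]
  have key := Measure.integral_comp_inv_smul (μ := (volume : Measure E)) (fun w =>
    Complex.exp (2 * Real.pi * Complex.I * (inner ℝ w (τ • t) : ℝ)) *
      ((‖𝓕 (wave A s τ) w‖ ^ 2 : ℝ) : ℂ)) (2 * Real.pi * τ)
  calc _ = ∫ u, ((volume.real A : ℂ)⁻¹ * ((|2 * Real.pi * τ| ^ Module.finrank ℝ E : ℝ) : ℂ)⁻¹) *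
      (Complex.exp (2 * Real.pi * Complex.I *
          (inner ℝ ((2 * Real.pi * τ)⁻¹ • u) (τ • t) : ℝ)) *
        ((‖𝓕 (wave A s τ) ((2 * Real.pi * τ)⁻¹ • u)‖ ^ 2 : ℝ) : ℂ)) := by
        refine integral_congr_ae (ae_of_all _ fun u => ?_)
        simp only []
        rw [ENNReal.toReal_ofReal (by positivity), Complex.real_smul, inner_smul_left,
          inner_smul_right]
        have : (2 * Real.pi * Complex.I * (((starRingEnd ℝ) (2 * Real.pi * τ)⁻¹ *
            (τ * inner ℝ u t) : ℝ) : ℂ)) = (inner ℝ u t : ℝ) * Complex.I := by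
          have hπ : (Real.pi : ℂ) ≠ 0 := by exact_mod_cast Real.pi_ne_zero
          have hτ' : (τ : ℂ) ≠ 0 := by exact_mod_cast hτ
          simp only [conj_trivial]
          push_cast
          field_simp
        rw [this]
        push_cast
        ring
    _ = _ := by
        rw [integral_const_mul, key, Complex.real_smul, ← mul_assoc]
        congr 1
        have hc' : ((|2 * Real.pi * τ| ^ Module.finrank ℝ E : ℝ) : ℂ) ≠ 0 := by
          exact_mod_cast (pow_ne_zero _ (abs_ne_zero.2 hc))
        rw [abs_pow]
        field_simp

/-- The total mass is the characteristic function at `0`, and the autocorrelation at zero shift is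
the volume of `A` because the wave has modulus one there. -/
theorem isProbabilityMeasure_spectralMeasure {A : Set E} (hA : MeasurableSet A)
    (hfin : volume A ≠ ⊤) (hpos : volume A ≠ 0) {s : E → ℝ} (hs : Measurable s) {τ : ℝ}
    (hτ : τ ≠ 0) : IsProbabilityMeasure (spectralMeasure A s τ) := by
  have h := charFun_spectralMeasure hA hfin hs hτ 0
  have hV : volume.real A ≠ 0 := (measureReal_ne_zero_iff hfin).2 hpos
  have e : ∫ x, wave A s τ (x + τ • (0 : E)) * starRingEnd ℂ (wave A s τ x) =
      (volume.real A : ℂ) := by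
    have : (fun x => wave A s τ (x + τ • (0 : E)) * starRingEnd ℂ (wave A s τ x)) =
        A.indicator fun _ => (1 : ℂ) := by
      funext x
      by_cases hx : x ∈ A
      · rw [smul_zero, add_zero, Complex.mul_conj', Set.indicator_of_mem hx, wave,
          Set.indicator_of_mem hx, norm_exp_phase]
        norm_num
      · simp [wave, hx]
    rw [this, integral_indicator hA]
    simp
  rw [charFun_zero, e, inv_mul_cancel₀ (by exact_mod_cast hV)] at h
  have h1 : (spectralMeasure A s τ).real Set.univ = 1 := by exact_mod_cast h
  refine ⟨?_⟩
  rw [Measure.real, ENNReal.toReal_eq_one_iff] at h1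
  exact h1

theorem measurable_gradient (s : E → ℝ) : Measurable (gradient s) :=
  (InnerProductSpace.toDual ℝ E).symm.continuous.measurable.comp (measurable_fderiv ℝ s)

/-- The law of the gradient of `s` at a uniformly distributed random point of `A`. -/
noncomputable def gradientLaw (A : Set E) (s : E → ℝ) : Measure E :=
  (ProbabilityTheory.cond volume A).map (gradient s)

theorem isProbabilityMeasure_gradientLaw {A : Set E} (hfin : volume A ≠ ⊤) (hpos : volume A ≠ 0)
    (s : E → ℝ) : IsProbabilityMeasure (gradientLaw A s) := by
  have : IsProbabilityMeasure (ProbabilityTheory.cond (volume : Measure E) A) :=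
    ProbabilityTheory.cond_isProbabilityMeasure_of_finite hpos hfin
  exact Measure.isProbabilityMeasure_map (measurable_gradient s).aemeasurable

theorem charFun_gradientLaw (A : Set E) (s : E → ℝ) (t : E) :
    charFun (gradientLaw A s) t = (volume.real A : ℂ)⁻¹ *
      ∫ x in A, Complex.exp ((inner ℝ (gradient s x) t : ℝ) * Complex.I) := by
  rw [charFun_apply, gradientLaw, integral_map (measurable_gradient s).aemeasurable
    (by fun_prop), ProbabilityTheory.cond, integral_smul_measure, ENNReal.toReal_inv,
    Complex.real_smul, Complex.ofReal_inv]
  rfl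

/-- The power spectra of `exp (i s / τ)` converge weakly to the law of the gradient of `s`. -/
theorem tendsto_spectralMeasure {A : Set E} (hA : IsOpen A) (hfin : volume A ≠ ⊤)
    (hpos : volume A ≠ 0) {s : E → ℝ} (hs : Measurable s)
    (hd : ∀ᵐ x, x ∈ A → DifferentiableAt ℝ s x) {B : Set E}
    (hB : gradientLaw A s (frontier B) = 0) :
    Tendsto (fun τ => spectralMeasure A s τ B) (𝓝[≠] 0) (𝓝 (gradientLaw A s B)) := by
  let ν : ProbabilityMeasure E := ⟨gradientLaw A s, isProbabilityMeasure_gradientLaw hfin hpos s⟩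
  -- At `τ = 0` the spectral measure need not have mass one; `ν` is a filler value that the
  -- punctured filter never sees.
  let μ : ℝ → ProbabilityMeasure E := fun τ => if h : τ = 0 then ν else
    ⟨spectralMeasure A s τ, isProbabilityMeasure_spectralMeasure hA.measurableSet hfin hpos hs h⟩
  have hμ : ∀ {τ}, τ ≠ 0 → (μ τ : Measure E) = spectralMeasure A s τ := fun {τ} h =>
    congrArg Subtype.val (dif_neg h)
  have key : Tendsto μ (𝓝[≠] 0) (𝓝 ν) := by
    refine tendsto_of_seq_tendsto fun v hv => ?_
    refine ProbabilityMeasure.tendsto_of_tendsto_charFun fun t => ?_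
    have h1 := ((tendsto_integral_wave_mul_conj hA hfin hs hd t).const_mul
      (volume.real A : ℂ)⁻¹).comp hv
    rw [← charFun_gradientLaw] at h1
    refine h1.congr' ?_
    have h2 : ∀ᶠ n in atTop, v n ≠ 0 := hv.eventually self_mem_nhdsWithin
    filter_upwards [h2] with n hn
    simp only [Function.comp_apply]
    rw [hμ hn, charFun_spectralMeasure hA.measurableSet hfin hs hn]
  have h := ProbabilityMeasure.tendsto_measure_of_null_frontier_of_tendsto' key (E := B) hB
  refine h.congr' ?_
  filter_upwards [self_mem_nhdsWithin] with τ hτ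
  rw [hμ hτ]

end Semiclassical

/-! ### Polar coordinates on sectors of arbitrary position. -/

namespace DistTransform

open scoped Real ENNReal

theorem dir_apply_zero (θ : ℝ) : dir θ 0 = Real.cos θ := rfl

theorem dir_apply_one (θ : ℝ) : dir θ 1 = Real.sin θ := rfl

theorem continuous_dir : Continuous dir := by
  unfold dir
  refine (PiLp.continuous_toLp 2 _).comp ?_
  refine continuous_pi fun i => ?_
  fin_cases i
  · exact Real.continuous_cos
  · exact Real.continuous_sin

theorem norm_dir (θ : ℝ) : ‖dir θ‖ = 1 := by
  rw [EuclideanSpace.norm_eq, Fin.sum_univ_two, dir_apply_zero, dir_apply_one]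
  simp

/-- The isometry of `ℂ` with the plane that takes `exp (i φ)` to `dir (φ + m)`. -/
noncomputable def polarIso (m : ℝ) : ℂ ≃ₗᵢ[ℝ] Plane :=
  (rotation (Circle.exp m)).trans Complex.orthonormalBasisOneI.repr

theorem polarIso_apply (m : ℝ) (p : ℝ × ℝ) :
    polarIso m (Complex.polarCoord.symm p) = p.1 • dir (p.2 + m) := by
  have h : (rotation (Circle.exp m)) (Complex.polarCoord.symm p) =
      (p.1 * Real.cos (p.2 + m) : ℝ) + (p.1 * Real.sin (p.2 + m) : ℝ) * Complex.I := by
    rw [Complex.polarCoord_symm_apply, rotation_apply, Circle.coe_exp, Complex.exp_mul_I,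
      Real.cos_add, Real.sin_add]
    push_cast
    linear_combination ((p.1 : ℂ) * Complex.sin m * Complex.sin p.2) * Complex.I_sq
  ext i
  rw [polarIso, LinearIsometryEquiv.trans_apply, h, PiLp.smul_apply, smul_eq_mul]
  generalize hC : Real.cos (p.2 + m) = C at *
  generalize hS : Real.sin (p.2 + m) = D at *
  fin_cases i <;> simp [dir, hC, hS]

theorem measurePreserving_polarIso (m : ℝ) : MeasurePreserving (polarIso m) :=
  LinearIsometryEquiv.measurePreserving _

/-- The points with polar coordinates in `U × J`. -/
def polarSet (U J : Set ℝ) : Set Plane := {X | ∃ r ∈ U, ∃ θ ∈ J, X = r • dir θ}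

/-- Rotating by the mid-angle `a + c` centres the sector at angle `0`, so for `c ≤ π` it avoids the
cut of the polar chart. -/
theorem polarSet_eq_image (U : Set ℝ) (a c : ℝ) :
    polarSet U (Set.Ioo a (a + 2 * c)) =
      polarIso (a + c) '' (Complex.polarCoord.symm '' (U ×ˢ Set.Ioo (-c) c)) := by
  ext X
  constructor
  · rintro ⟨r, hr, θ, hθ, rfl⟩
    refine ⟨_, ⟨(r, θ - (a + c)), ⟨hr, ?_⟩, rfl⟩, ?_⟩
    · constructor <;> linarith [hθ.1, hθ.2]
    · rw [polarIso_apply]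
      simp
  · rintro ⟨_, ⟨p, ⟨hp1, hp2⟩, rfl⟩, rfl⟩
    refine ⟨p.1, hp1, p.2 + (a + c), ?_, polarIso_apply _ _⟩
    constructor <;> linarith [hp2.1, hp2.2]

theorem isOpen_polarSet {U : Set ℝ} (hU : IsOpen U) (hU0 : U ⊆ Set.Ioi 0) (a : ℝ) {c : ℝ}
    (hc : c ≤ π) : IsOpen (polarSet U (Set.Ioo a (a + 2 * c))) := by
  rw [polarSet_eq_image]
  refine (polarIso (a + c)).toHomeomorph.isOpenMap _ ?_
  refine Complex.polarCoord.symm.isOpen_image_of_subset_source (hU.prod isOpen_Ioo) ?_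
  rw [OpenPartialHomeomorph.symm_source, Complex.polarCoord_target]
  exact Set.prod_mono hU0 (Set.Ioo_subset_Ioo (by linarith) hc)

/-- Integration in polar coordinates over a sector. -/
theorem setLIntegral_sector {g : Plane → ℝ≥0∞} (hg : Measurable g) (a : ℝ) {c : ℝ} (hc : c ≤ π) :
    ∫⁻ X in polarSet (Set.Ioi 0) (Set.Ioo a (a + 2 * c)), g X =
      ∫⁻ θ in Set.Ioo a (a + 2 * c), ∫⁻ r in Set.Ioi (0 : ℝ),
        ENNReal.ofReal r * g (r • dir θ) := by
  have hopen : IsOpen (polarSet (Set.Ioi 0) (Set.Ioo a (a + 2 * c))) :=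
    isOpen_polarSet isOpen_Ioi subset_rfl a hc
  have hsub : Set.Ioi (0 : ℝ) ×ˢ Set.Ioo (-c) c ⊆ polarCoord.target :=
    Set.prod_mono subset_rfl (Set.Ioo_subset_Ioo (by linarith) hc)
  have hmeas : Measurable fun p : ℝ × ℝ => ENNReal.ofReal p.1 * g (p.1 • dir (p.2 + (a + c))) := by
    have h1 : Continuous fun p : ℝ × ℝ => p.1 • dir (p.2 + (a + c)) :=
      continuous_fst.smul (continuous_dir.comp (by fun_prop))
    exact (by fun_prop : Measurable fun p : ℝ × ℝ => ENNReal.ofReal p.1).mul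
      (hg.comp h1.measurable)
  have e1 : ∀ p ∈ polarCoord.target, ENNReal.ofReal p.1 •
      (polarSet (Set.Ioi 0) (Set.Ioo a (a + 2 * c))).indicator g
        (polarIso (a + c) (Complex.polarCoord.symm p)) =
      (Set.Ioi (0 : ℝ) ×ˢ Set.Ioo (-c) c).indicator
        (fun p => ENNReal.ofReal p.1 * g (p.1 • dir (p.2 + (a + c)))) p := by
    intro p hp
    have hiff : polarIso (a + c) (Complex.polarCoord.symm p) ∈
        polarSet (Set.Ioi 0) (Set.Ioo a (a + 2 * c)) ↔ p ∈ Set.Ioi (0 : ℝ) ×ˢ Set.Ioo (-c) c := by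
      rw [polarSet_eq_image, (polarIso (a + c)).injective.mem_set_image]
      constructor
      · rintro ⟨q, hq, h⟩
        rwa [← Complex.polarCoord.symm.injOn (hsub hq) hp h]
      · exact fun h => ⟨p, h, rfl⟩
    by_cases h : p ∈ Set.Ioi (0 : ℝ) ×ˢ Set.Ioo (-c) c
    · rw [Set.indicator_of_mem h, Set.indicator_of_mem (hiff.2 h), polarIso_apply, smul_eq_mul]
    · rw [Set.indicator_of_notMem h, Set.indicator_of_notMem (fun h' => h (hiff.1 h')), smul_zero]
  rw [← lintegral_indicator hopen.measurableSet,
    ← (measurePreserving_polarIso (a + c)).lintegral_comp_emb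
      (polarIso (a + c)).toHomeomorph.measurableEmbedding,
    ← Complex.lintegral_comp_polarCoord_symm,
    setLIntegral_congr_fun polarCoord.open_target.measurableSet e1,
    setLIntegral_indicator (measurableSet_Ioi.prod measurableSet_Ioo),
    Set.inter_eq_left.2 hsub, Measure.volume_eq_prod,
    setLIntegral_prod_symm _ hmeas.aemeasurable.restrict]
  have e2 := (measurePreserving_add_right (volume : Measure ℝ) (a + c)).setLIntegral_comp_preimage_emb
    (measurableEmbedding_addRight (a + c))
    (fun θ => ∫⁻ r in Set.Ioi (0 : ℝ), ENNReal.ofReal r * g (r • dir θ))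
    (Set.Ioo a (a + 2 * c))
  rw [← e2, Set.preimage_add_const_Ioo]
  congr 3
  · ring_nf
  · ring_nf

end DistTransform

/-! ### Star bodies, their homothetic copies and shells. -/

namespace DistTransform

open scoped Real ENNReal

/-- The length of the ray of `C` from `y` with orientation `θ`. -/
noncomputable def radial (C : Set Plane) (y : Plane) (θ : ℝ) : ℝ :=
  sSup {r : ℝ | 0 ≤ r ∧ y + r • dir θ ∈ C}

/-- Compactness makes the supremum attained, and star-shapedness fills in all smaller radii.
Membership in `C` thus becomes an inequality for the radial function. -/
theorem le_radial_iff {C : Set Plane} {y : Plane} (hC : IsCompact C) (hst : StarConvex ℝ y C)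
    (hy : y ∈ C) {θ r : ℝ} (hr : 0 ≤ r) : r ≤ radial C y θ ↔ y + r • dir θ ∈ C := by
  set T : Set ℝ := {r : ℝ | 0 ≤ r ∧ y + r • dir θ ∈ C} with hT
  have hcont : Continuous fun r : ℝ => y + r • dir θ := by fun_prop
  have hclosed : IsClosed T := isClosed_Ici.inter (hC.isClosed.preimage hcont)
  have hne : T.Nonempty := ⟨0, le_rfl, by simpa using hy⟩
  have hbdd : BddAbove T := by
    obtain ⟨M, hM⟩ := hC.isBounded.subset_closedBall y
    refine ⟨M, fun r hr => ?_⟩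
    have := hM hr.2
    rw [Metric.mem_closedBall, dist_eq_norm, add_sub_cancel_left, norm_smul, norm_dir, mul_one,
      Real.norm_of_nonneg hr.1] at this
    exact this
  constructor
  · intro h
    have hmem : radial C y θ ∈ T := hclosed.csSup_mem hne hbdd
    rcases hr.eq_or_lt with rfl | hr0
    · simpa using hy
    have hR : 0 < radial C y θ := hr0.trans_le h
    have h1 := hst hmem.2 (a := 1 - r / radial C y θ) (b := r / radial C y θ)
      (sub_nonneg.2 ((div_le_one hR).2 h)) (by positivity) (by ring)
    convert h1 using 1
    rw [smul_add, smul_smul, div_mul_cancel₀ _ hR.ne', sub_smul, one_smul]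
    abel
  · exact fun h => le_csSup hbdd ⟨hr, h⟩

theorem radial_nonneg (C : Set Plane) (y : Plane) (θ : ℝ) : 0 ≤ radial C y θ :=
  Real.sSup_nonneg fun _ h => h.1

/-- For `r > 0` the superlevel set is the preimage of the closed set `C` under a continuous map. -/
theorem measurable_radial {C : Set Plane} {y : Plane} (hC : IsCompact C) (hst : StarConvex ℝ y C)
    (hy : y ∈ C) : Measurable (radial C y) := by
  refine measurable_of_Ici fun r => ?_
  rcases le_or_gt r 0 with hr | hr
  · convert MeasurableSet.univ
    exact Set.eq_univ_of_forall fun θ => hr.trans (radial_nonneg C y θ)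
  · have hcont : Continuous fun θ : ℝ => y + r • dir θ :=
      continuous_const.add (continuous_dir.const_smul r)
    convert (hC.isClosed.preimage hcont).measurableSet
    ext θ
    exact le_radial_iff hC hst hy hr.le

theorem lintegral_Ioc_ofReal {ρ : ℝ} (hρ : 0 ≤ ρ) :
    ∫⁻ r in Set.Ioc 0 ρ, ENNReal.ofReal r = ENNReal.ofReal (ρ ^ 2 / 2) := by
  rw [← ofReal_integral_eq_lintegral_ofReal, ← intervalIntegral.integral_of_le hρ, integral_id]
  · simp
  · exact (continuous_id.integrableOn_Icc).mono_set Set.Ioc_subset_Icc_self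
  · exact (ae_restrict_iff' measurableSet_Ioc).2 (ae_of_all _ fun r hr => hr.1.le)

/-- The area of a sector of a star body. -/
theorem volume_inter_sector {C : Set Plane} {y : Plane} (hC : IsCompact C)
    (hst : StarConvex ℝ y C) (hy : y ∈ C) (a : ℝ) {c : ℝ} (hc : c ≤ π) :
    volume (C ∩ {X | X - y ∈ polarSet (Set.Ioi 0) (Set.Ioo a (a + 2 * c))}) =
      ∫⁻ θ in Set.Ioo a (a + 2 * c), ENNReal.ofReal (radial C y θ ^ 2 / 2) := by
  set P := polarSet (Set.Ioi 0) (Set.Ioo a (a + 2 * c)) with hP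
  have hPm : MeasurableSet P := (isOpen_polarSet isOpen_Ioi subset_rfl a hc).measurableSet
  have hD : MeasurableSet ((fun X => y + X) ⁻¹' C) :=
    hC.measurableSet.preimage (measurable_const_add y)
  have e0 : (fun X => y + X) ⁻¹' (C ∩ {X | X - y ∈ P}) = (fun X => y + X) ⁻¹' C ∩ P := by
    ext X
    simp
  rw [← measure_preimage_add volume y, e0, ← lintegral_indicator_one (hD.inter hPm),
    Set.inter_comm, ← Set.indicator_indicator, lintegral_indicator hPm,
    setLIntegral_sector (measurable_one.indicator hD) a hc]
  refine setLIntegral_congr_fun measurableSet_Ioo fun θ _ => ?_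
  rw [← lintegral_Ioc_ofReal (radial_nonneg C y θ),
    ← Set.inter_eq_left.2 (Set.Ioc_subset_Ioi_self : Set.Ioc 0 (radial C y θ) ⊆ Set.Ioi 0),
    ← setLIntegral_indicator measurableSet_Ioc]
  refine setLIntegral_congr_fun measurableSet_Ioi fun r hr => ?_
  have h := le_radial_iff hC hst hy (θ := θ) (le_of_lt hr)
  by_cases hr' : r ≤ radial C y θ
  · rw [Set.indicator_of_mem (show r • dir θ ∈ _ from h.1 hr'), Set.indicator_of_mem (show r ∈ Set.Ioc 0 (radial C y θ) from ⟨hr, hr'⟩)]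
    simp
  · rw [Set.indicator_of_notMem (show r • dir θ ∉ _ from fun h' => hr' (h.2 h')),
      Set.indicator_of_notMem (show r ∉ Set.Ioc 0 (radial C y θ) from fun h' => hr' h'.2)]
    simp

theorem exists_dir_eq (X y : Plane) : ∃ θ ∈ Set.Ico 0 (2 * π), X = y + ‖X - y‖ • dir θ := by
  obtain ⟨z, hz⟩ := (polarIso 0).surjective (X - y)
  have hn : ‖X - y‖ = ‖z‖ := by rw [← hz, LinearIsometryEquiv.norm_map]
  refine ⟨toIcoMod Real.two_pi_pos 0 z.arg, ?_, ?_⟩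
  · simpa using toIcoMod_mem_Ico Real.two_pi_pos 0 z.arg
  · have h1 : dir (toIcoMod Real.two_pi_pos 0 z.arg) = dir z.arg := by
      obtain ⟨n, hn⟩ : ∃ n : ℤ, toIcoMod Real.two_pi_pos 0 z.arg = z.arg - n * (2 * π) :=
        ⟨toIcoDiv Real.two_pi_pos 0 z.arg, by
          rw [toIcoMod, zsmul_eq_mul]⟩
      rw [dir, dir, hn, Real.cos_sub_int_mul_two_pi, Real.sin_sub_int_mul_two_pi]
    have h2 := polarIso_apply 0 (‖z‖, z.arg)
    rw [Complex.polarCoord_symm_apply, add_zero] at h2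
    have h3 : ((‖z‖ : ℝ) : ℂ) * (Real.cos z.arg + Real.sin z.arg * Complex.I) = z := by
      push_cast
      exact Complex.norm_mul_cos_add_sin_mul_I z
    rw [h3, hz] at h2
    rw [h1, hn, ← h2]
    abel

/-- The image of `C` under the homothety of centre `y` and ratio `s`. -/
noncomputable def shrink (C : Set Plane) (y : Plane) (s : ℝ) : Set Plane :=
  AffineMap.homothety y s '' C

theorem mem_shrink_iff {C : Set Plane} {y : Plane} {s : ℝ} (hs : s ≠ 0) {X : Plane} :
    X ∈ shrink C y s ↔ y + s⁻¹ • (X - y) ∈ C := by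
  constructor
  · rintro ⟨Z, hZ, rfl⟩
    simpa [AffineMap.homothety_apply, smul_smul, hs] using hZ
  · intro h
    exact ⟨_, h, by simp [AffineMap.homothety_apply, smul_smul, hs]⟩

theorem volume_shrink (C : Set Plane) (y : Plane) (s : ℝ) :
    volume (shrink C y s) = ENNReal.ofReal (s ^ 2) * volume C := by
  rw [shrink, Measure.addHaar_image_homothety, finrank_euclideanSpace_fin, abs_sq]

theorem isCompact_shrink {C : Set Plane} (hC : IsCompact C) (y : Plane) (s : ℝ) :
    IsCompact (shrink C y s) :=
  hC.image (AffineMap.homothety_continuous y s)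

theorem isOpen_shrink {C : Set Plane} (hC : IsOpen C) (y : Plane) {s : ℝ} (hs : s ≠ 0) :
    IsOpen (shrink C y s) :=
  AffineMap.homothety_isOpenMap y s hs _ hC

theorem mem_shrink_iff_le {C : Set Plane} {y : Plane} (hC : IsCompact C) (hst : StarConvex ℝ y C)
    (hy : y ∈ C) {s r θ : ℝ} (hs : 0 < s) (hr : 0 ≤ r) :
    y + r • dir θ ∈ shrink C y s ↔ r ≤ s * radial C y θ := by
  rw [mem_shrink_iff hs.ne', add_sub_cancel_left, smul_smul,
    ← le_radial_iff hC hst hy (by positivity), inv_mul_le_iff₀ hs]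

theorem shrink_mono {C : Set Plane} {y : Plane} (hC : IsCompact C) (hst : StarConvex ℝ y C)
    (hy : y ∈ C) {s t : ℝ} (hs : 0 < s) (hst' : s ≤ t) : shrink C y s ⊆ shrink C y t := by
  intro X hX
  obtain ⟨θ, -, h⟩ := exists_dir_eq X y
  rw [h] at hX ⊢
  rw [mem_shrink_iff_le hC hst hy hs (norm_nonneg _)] at hX
  rw [mem_shrink_iff_le hC hst hy (hs.trans_le hst') (norm_nonneg _)]
  exact hX.trans (mul_le_mul_of_nonneg_right hst' (radial_nonneg _ _ _))

theorem shrink_one (C : Set Plane) (y : Plane) : shrink C y 1 = C := by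
  simp [shrink]

/-- The points of a star body that lie in no smaller homothetic copy form a null set. -/
theorem volume_rim {C : Set Plane} {y : Plane} (hC : IsCompact C) (hst : StarConvex ℝ y C)
    (hy : y ∈ C) : volume {X ∈ C | ∀ s ∈ Set.Ioo (0 : ℝ) 1, X ∉ shrink C y s} = 0 := by
  have hle : ∀ s ∈ Set.Ioo (0 : ℝ) 1,
      volume {X ∈ C | ∀ s ∈ Set.Ioo (0 : ℝ) 1, X ∉ shrink C y s} ≤
        volume C - ENNReal.ofReal (s ^ 2) * volume C := by
    intro s hs
    rw [← volume_shrink, ← measure_sdiff _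
      (isCompact_shrink hC y s).measurableSet.nullMeasurableSet
      (isCompact_shrink hC y s).measure_lt_top.ne]
    · exact measure_mono fun X hX => ⟨hX.1, hX.2 s hs⟩
    · have := shrink_mono hC hst hy hs.1 hs.2.le
      rwa [shrink_one] at this
  -- The copy of ratio `s` lies in `C` and has `s²` times its area, so what is left over vanishes as
  -- `s → 1`.
  have hlim : Tendsto (fun s : ℝ => volume C - ENNReal.ofReal (s ^ 2) * volume C) (𝓝[<] 1)
      (𝓝 (volume C - ENNReal.ofReal (1 ^ 2) * volume C)) := by
    refine ENNReal.Tendsto.sub tendsto_const_nhds (ENNReal.Tendsto.mul_const ?_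
      (Or.inr hC.measure_lt_top.ne)) (Or.inl hC.measure_lt_top.ne)
    exact ((ENNReal.continuous_ofReal.comp (continuous_pow 2)).tendsto 1).mono_left
      nhdsWithin_le_nhds
  rw [one_pow, ENNReal.ofReal_one, one_mul, tsub_self] at hlim
  refine le_antisymm (ge_of_tendsto hlim ?_) zero_le
  filter_upwards [Ioo_mem_nhdsLT (zero_lt_one' ℝ)] with s hs using hle s hs

/-- The points `y + r • dir θ` with `ε R(θ) ≤ r ≤ (1 - ε) R(θ)`. -/
noncomputable def shell (C : Set Plane) (y : Plane) (ε : ℝ) : Set Plane :=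
  {X | ∃ θ ∈ Set.Ico 0 (2 * π), ∃ r ∈ Set.Icc (ε * radial C y θ) ((1 - ε) * radial C y θ),
    X = y + r • dir θ}

section Shell

variable {C : Set Plane} {y : Plane} (hC : IsCompact C) (hst : StarConvex ℝ y C)
  (hy : y ∈ C) {ε : ℝ} (hε : 0 < ε) (hε' : ε < 1 / 2)

include hC hst hy hε

/-- The overlap is the inner rim `r = ε R(θ)`, together possibly with `y`. That rim is the
homothetic image of the rim of `C`, hence null although the radial function need not be continuous.
-/
theorem volume_shell_inter_shrink : volume (shell C y ε ∩ shrink C y ε) = 0 := by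
  have hsub : shell C y ε ∩ shrink C y ε ⊆
      {y} ∪ shrink {X ∈ C | ∀ s ∈ Set.Ioo (0 : ℝ) 1, X ∉ shrink C y s} y ε := by
    rintro _ ⟨⟨θ, -, r, hr, rfl⟩, hX⟩
    have hr0 : 0 ≤ r := (mul_nonneg hε.le (radial_nonneg C y θ)).trans hr.1
    rcases hr0.eq_or_lt with rfl | hrpos
    · left
      simp
    right
    have hX' := (mem_shrink_iff hε.ne').1 hX
    rw [add_sub_cancel_left, smul_smul] at hX'
    rw [mem_shrink_iff hε.ne', add_sub_cancel_left, smul_smul]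
    refine ⟨hX', fun s hs h => ?_⟩
    rw [mem_shrink_iff_le hC hst hy hs.1 (by positivity), inv_mul_le_iff₀ hε] at h
    have hR : 0 < radial C y θ := by
      by_contra hneg
      have h0 : radial C y θ = 0 := le_antisymm (not_lt.1 hneg) (radial_nonneg _ _ _)
      rw [h0] at h
      simp at h
      linarith
    have : ε * (s * radial C y θ) < ε * radial C y θ :=
      mul_lt_mul_of_pos_left (by nlinarith [hs.2]) hε
    linarith [hr.1]
  refine measure_mono_null hsub (measure_union_null (by simp) ?_)
  rw [volume_shrink, volume_rim hC hst hy, mul_zero]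

include hε'

theorem shell_subset_shrink : shell C y ε ⊆ shrink C y (1 - ε) := by
  rintro _ ⟨θ, -, r, hr, rfl⟩
  have hr0 : 0 ≤ r := (mul_nonneg hε.le (radial_nonneg C y θ)).trans hr.1
  exact (mem_shrink_iff_le hC hst hy (by linarith) hr0).2 hr.2

theorem diff_shrink_subset_shell : shrink C y (1 - ε) \ shrink C y ε ⊆ shell C y ε := by
  rintro X ⟨h1, h2⟩
  obtain ⟨θ, hθ, h⟩ := exists_dir_eq X y
  rw [h] at h1 h2
  rw [mem_shrink_iff_le hC hst hy (by linarith) (norm_nonneg _)] at h1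
  rw [mem_shrink_iff_le hC hst hy hε (norm_nonneg _), not_le] at h2
  exact ⟨θ, hθ, _, ⟨h2.le, h1⟩, h⟩

theorem shell_ae_eq : shell C y ε =ᵐ[volume] (shrink C y (1 - ε) \ shrink C y ε : Set Plane) := by
  have h0 := volume_shell_inter_shrink hC hst hy hε
  refine (ae_eq_set.2 ⟨measure_mono_null ?_ h0, ?_⟩)
  · rintro X ⟨h1, h2⟩
    refine ⟨h1, ?_⟩
    by_contra h3
    exact h2 ⟨shell_subset_shrink hC hst hy hε hε' h1, h3⟩
  · rw [Set.sdiff_eq_empty.2 (diff_shrink_subset_shell hC hst hy hε hε'), measure_empty]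

/-- The shell takes up the same proportion of every cone. -/
theorem volume_shell_inter_cone {K : Set Plane} (hK : MeasurableSet K)
    (hKs : ∀ s : ℝ, 0 < s → ∀ x, s • x ∈ K ↔ x ∈ K) :
    volume (shell C y ε ∩ {X | X - y ∈ K}) =
      ENNReal.ofReal (1 - 2 * ε) * volume (C ∩ {X | X - y ∈ K}) := by
  have hKm : MeasurableSet {X | X - y ∈ K} := hK.preimage (measurable_sub_const y)
  have hcone : ∀ s : ℝ, 0 < s → shrink C y s ∩ {X | X - y ∈ K} =
      shrink (C ∩ {X | X - y ∈ K}) y s := by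
    intro s hs
    ext X
    rw [Set.mem_inter_iff, mem_shrink_iff hs.ne', mem_shrink_iff hs.ne', Set.mem_inter_iff]
    simp [hKs s⁻¹ (inv_pos.2 hs)]
  have hfin : volume (C ∩ {X | X - y ∈ K}) ≠ ⊤ :=
    measure_ne_top_of_subset Set.inter_subset_left hC.measure_lt_top.ne
  have hae : (shell C y ε ∩ {X | X - y ∈ K} : Set Plane) =ᵐ[volume]
      ((shrink C y (1 - ε) \ shrink C y ε) ∩ {X | X - y ∈ K} : Set Plane) :=
    (shell_ae_eq hC hst hy hε hε').inter (ae_eq_refl _)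
  have e1 : (shrink C y (1 - ε) \ shrink C y ε) ∩ {X | X - y ∈ K} =
      shrink (C ∩ {X | X - y ∈ K}) y (1 - ε) \ shrink (C ∩ {X | X - y ∈ K}) y ε := by
    rw [← hcone _ hε, ← hcone _ (by linarith : 0 < 1 - ε)]
    ext X
    simp only [Set.mem_inter_iff, Set.mem_sdiff]
    tauto
  -- A cone is invariant under homotheties, so the two areas carry the factors `(1-ε)²` and `ε²`,
  -- whose difference is `1 - 2ε`.
  rw [measure_congr hae, e1, measure_sdiff, volume_shrink, volume_shrink,
    ← ENNReal.sub_mul (fun _ _ => hfin), ← ENNReal.ofReal_sub _ (sq_nonneg ε)]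
  · congr 2
    ring
  · rw [← hcone _ hε, ← hcone _ (by linarith : 0 < 1 - ε)]
    exact Set.inter_subset_inter_left _ (shrink_mono hC hst hy hε (by linarith))
  · rw [← hcone _ hε]
    exact ((isCompact_shrink hC y ε).measurableSet.inter hKm).nullMeasurableSet
  · rw [volume_shrink]
    exact ENNReal.mul_ne_top ENNReal.ofReal_ne_top hfin

/-- Almost every point of the shell is an interior point. -/
theorem volume_shell_diff_interior (hfr : volume (frontier C) = 0) :
    volume (shell C y ε \ interior (shell C y ε)) = 0 := by
  have hopen : shrink (interior C) y (1 - ε) \ shrink C y ε ⊆ interior (shell C y ε) := by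
    refine interior_maximal ?_ ((isOpen_shrink isOpen_interior y (by linarith)).sdiff
      (isCompact_shrink hC y ε).isClosed)
    exact (Set.sdiff_subset_sdiff_left (Set.image_mono interior_subset)).trans
      (diff_shrink_subset_shell hC hst hy hε hε')
  -- A non-interior point lies either on the inner rim or on the scaled frontier of `C`.
  have hsub : shell C y ε \ interior (shell C y ε) ⊆
      shell C y ε ∩ shrink C y ε ∪ shrink (frontier C) y (1 - ε) := by
    rintro X ⟨h1, h2⟩
    by_cases h3 : X ∈ shrink C y ε
    · exact Or.inl ⟨h1, h3⟩
    right
    have h4 := shell_subset_shrink hC hst hy hε hε' h1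
    have hne : 1 - ε ≠ 0 := by linarith
    rw [mem_shrink_iff hne] at h4 ⊢
    refine ⟨subset_closure h4, fun h5 => h2 (hopen ⟨?_, h3⟩)⟩
    rwa [mem_shrink_iff hne]
  refine measure_mono_null hsub (measure_union_null (volume_shell_inter_shrink hC hst hy hε) ?_)
  rw [volume_shrink, hfr, mul_zero]

end Shell

end DistTransform

/-! ### Voronoi cells and the gradient of the distance transform. -/

namespace DistTransform

open scoped Real ENNReal

variable {K : ℕ}

/-- The open Voronoi cell of `Y k` in the plane. -/
def openCell (Y : Fin K → Plane) (k : Fin K) : Set Plane :=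
  {X | ∀ j, j ≠ k → ‖X - Y k‖ < ‖X - Y j‖}

theorem isOpen_openCell (Y : Fin K → Plane) (k : Fin K) : IsOpen (openCell Y k) := by
  simp only [openCell, Set.ofPred_forall]
  exact isOpen_iInter_of_finite fun j => isOpen_iInter_of_finite fun _ =>
    isOpen_lt (by fun_prop) (by fun_prop)

theorem measurable_S (Y : Fin K → Plane) : Measurable (S Y) := by
  unfold S
  exact Measurable.iInf fun k => by fun_prop

theorem S_eq_of_forall_le {Y : Fin K → Plane} {k : Fin K} {X : Plane}
    (h : ∀ j, ‖X - Y k‖ ≤ ‖X - Y j‖) : S Y X = ‖X - Y k‖ := by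
  have : Nonempty (Fin K) := ⟨k⟩
  exact le_antisymm (ciInf_le (Set.finite_range _).bddBelow k) (le_ciInf h)

theorem hasGradientAt_S {Y : Fin K → Plane} {k : Fin K} {X : Plane} (hX : X ∈ openCell Y k)
    (hne : X ≠ Y k) : HasGradientAt (S Y) (‖X - Y k‖⁻¹ • (X - Y k)) X := by
  have hn : ‖X - Y k‖ ≠ 0 := norm_ne_zero_iff.2 (sub_ne_zero.2 hne)
  have h1 : HasGradientAt (fun Z => ‖Z - Y k‖) (‖X - Y k‖⁻¹ • (X - Y k)) X := by
    rw [hasGradientAt_iff_hasFDerivAt]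
    have h2 := ((hasFDerivAt_id X).sub_const (Y k)).norm_sq.sqrt (pow_ne_zero 2 hn)
    simp only [Real.sqrt_sq (norm_nonneg _)] at h2
    refine h2.congr_fderiv ?_
    ext v
    simp
    field_simp
  refine h1.congr_of_eventuallyEq ?_
  filter_upwards [(isOpen_openCell Y k).mem_nhds hX] with Z hZ
  refine S_eq_of_forall_le fun j => ?_
  rcases eq_or_ne j k with rfl | hj
  · exact le_rfl
  · exact (hZ j hj).le

theorem volume_bisector {a b : Plane} (h : a ≠ b) : volume {X | ‖X - a‖ = ‖X - b‖} = 0 := by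
  have e : {X | ‖X - a‖ = ‖X - b‖} = (AffineSubspace.perpBisector a b : Set Plane) := by
    ext X
    rw [SetLike.mem_coe, AffineSubspace.mem_perpBisector_iff_dist_eq, dist_eq_norm, dist_eq_norm,
      Set.mem_ofPred_eq]
  rw [e]
  exact Measure.addHaar_affineSubspace _ _ (by simpa using h)

theorem ae_norm_sub_ne {Y : Fin K → Plane} (hY : Function.Injective Y) :
    ∀ᵐ X, ∀ k j, k ≠ j → ‖X - Y k‖ ≠ ‖X - Y j‖ := by
  simp only [ae_all_iff]
  intro k j hkj
  rw [ae_iff]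
  simpa using volume_bisector (hY.ne hkj)

theorem ae_ne (Y : Fin K → Plane) : ∀ᵐ X, ∀ k, X ≠ Y k := by
  rw [ae_all_iff]
  intro k
  rw [ae_iff]
  simp

/-- Off the finitely many bisectors, which are null lines, the nearest centre is strictly nearest.
-/
theorem ae_mem_openCell {Y : Fin K → Plane} (hY : Function.Injective Y) :
    ∀ᵐ X, ∀ k, X ≠ Y k ∧ ((∀ j, ‖X - Y k‖ ≤ ‖X - Y j‖) → X ∈ openCell Y k) := by
  filter_upwards [ae_norm_sub_ne hY, ae_ne Y] with X h1 h2 k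
  exact ⟨h2 k, fun h j hj => (h j).lt_of_ne (h1 k j hj.symm)⟩

theorem exists_nearest (hK : 0 < K) (Y : Fin K → Plane) (X : Plane) :
    ∃ k, ∀ j, ‖X - Y k‖ ≤ ‖X - Y j‖ := by
  have : Nonempty (Fin K) := ⟨⟨0, hK⟩⟩
  exact Finite.exists_min _

theorem ae_differentiableAt_S (hK : 0 < K) {Y : Fin K → Plane} (hY : Function.Injective Y) :
    ∀ᵐ X, DifferentiableAt ℝ (S Y) X := by
  filter_upwards [ae_mem_openCell hY] with X h
  obtain ⟨k, hk⟩ := exists_nearest hK Y X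
  exact (hasGradientAt_S ((h k).2 hk) (h k).1).differentiableAt

theorem isClosed_nearest (Y : Fin K → Plane) (k : Fin K) :
    IsClosed {X | ∀ j, ‖X - Y k‖ ≤ ‖X - Y j‖} := by
  simp only [Set.ofPred_forall]
  exact isClosed_iInter fun j => isClosed_le (by fun_prop) (by fun_prop)

theorem isCompact_cell {Ω : Set Plane} (hΩ : IsCompact Ω) (Y : Fin K → Plane) (k : Fin K) :
    IsCompact (cell Ω Y k) :=
  hΩ.inter_right (isClosed_nearest Y k)

theorem iUnion_cell (hK : 0 < K) (Ω : Set Plane) (Y : Fin K → Plane) :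
    ⋃ k, cell Ω Y k = Ω := by
  ext X
  simp only [Set.mem_iUnion]
  constructor
  · rintro ⟨k, h⟩
    exact h.1
  · intro h
    obtain ⟨k, hk⟩ := exists_nearest hK Y X
    exact ⟨k, h, hk⟩

theorem volume_segment (a b : Plane) : volume (segment ℝ a b) = 0 := by
  have hsub : segment ℝ a b ⊆ (affineSpan ℝ {a, b} : Set Plane) := by
    rw [← convexHull_pair]
    exact convexHull_subset_affineSpan _
  refine measure_mono_null hsub (Measure.addHaar_affineSubspace _ _ fun h => ?_)
  have h1 : Module.finrank ℝ (vectorSpan ℝ ({a, b} : Set Plane)) ≤ 1 := by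
    rw [vectorSpan_pair]
    exact (finrank_span_le_card _).trans (by simp)
  rw [← direction_affineSpan, h, AffineSubspace.direction_top, finrank_top,
    finrank_euclideanSpace_fin] at h1
  omega

theorem HasPolygonalBoundary.volume_frontier {Ω : Set Plane} (h : HasPolygonalBoundary Ω) :
    volume (frontier Ω) = 0 := by
  obtain ⟨s, hs⟩ := h
  rw [hs]
  exact (measure_biUnion_null_iff s.countable_toSet).2 fun q _ => volume_segment _ _

theorem volume_frontier_cell {Ω : Set Plane} (hΩ : volume (frontier Ω) = 0) {Y : Fin K → Plane}
    (hY : Function.Injective Y) (k : Fin K) : volume (frontier (cell Ω Y k)) = 0 := by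
  refine measure_mono_null (frontier_inter_subset Ω {X | ∀ j, ‖X - Y k‖ ≤ ‖X - Y j‖}) ?_
  refine measure_union_null (measure_mono_null Set.inter_subset_left hΩ)
    (measure_mono_null Set.inter_subset_right ?_)
  have h := ae_mem_openCell hY
  rw [ae_iff] at h
  refine measure_mono_null ?_ h
  intro X hX hX'
  rw [(isClosed_nearest Y k).frontier_eq] at hX
  refine hX.2 (interior_maximal ?_ (isOpen_openCell Y k) ((hX' k).2 hX.1))
  intro Z hZ j
  rcases eq_or_ne j k with rfl | hj
  · exact le_rfl
  · exact (hZ j hj).le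

/-- The points whose direction from the origin is in `B`. -/
def cone (B : Set Plane) : Set Plane := {x | ‖x‖⁻¹ • x ∈ B}

theorem measurableSet_cone {B : Set Plane} (hB : MeasurableSet B) : MeasurableSet (cone B) :=
  hB.preimage (by fun_prop)

theorem smul_mem_cone_iff (B : Set Plane) (s : ℝ) (hs : 0 < s) (x : Plane) :
    s • x ∈ cone B ↔ x ∈ cone B := by
  simp only [cone, Set.mem_ofPred_eq]
  rw [norm_smul, Real.norm_of_nonneg hs.le, smul_smul, mul_inv_rev, mul_assoc,
    inv_mul_cancel₀ hs.ne', mul_one]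

/-- This turns a condition on the gradient into a cone with apex `Y k`, which homotheties about that
centre preserve. -/
theorem ae_gradient_S_mem_iff {Y : Fin K → Plane} (hY : Function.Injective Y) (B : Set Plane) :
    ∀ᵐ X, ∀ k, (∀ j, ‖X - Y k‖ ≤ ‖X - Y j‖) → (gradient (S Y) X ∈ B ↔ X - Y k ∈ cone B) := by
  filter_upwards [ae_mem_openCell hY] with X h k hk
  rw [(hasGradientAt_S ((h k).2 hk) (h k).1).gradient]
  rfl

/-- The area of the part of a union of subsets of the cells on which the gradient of `S` is in a
given set. -/
theorem volume_iUnion_inter_gradient_mem {Y : Fin K → Plane} (hY : Function.Injective Y)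
    {U : Fin K → Set Plane} (hU : ∀ k, NullMeasurableSet (U k))
    (hUle : ∀ k, ∀ X ∈ U k, ∀ j, ‖X - Y k‖ ≤ ‖X - Y j‖) {B : Set Plane} (hB : MeasurableSet B) :
    volume ((⋃ k, U k) ∩ {X | gradient (S Y) X ∈ B}) =
      ∑ k, volume (U k ∩ {X | X - Y k ∈ cone B}) := by
  have hBm : MeasurableSet {X | gradient (S Y) X ∈ B} := measurable_gradient (S Y) hB
  rw [Set.iUnion_inter, measure_iUnion₀, tsum_fintype]
  · refine Finset.sum_congr rfl fun k _ => measure_congr ?_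
    filter_upwards [ae_gradient_S_mem_iff hY B] with X h
    refine propext ⟨fun hX => ⟨hX.1, ?_⟩, fun hX => ⟨hX.1, ?_⟩⟩
    · exact (h k (hUle k X hX.1)).1 hX.2
    · exact (h k (hUle k X hX.1)).2 hX.2
  · intro k j hkj
    have h := ae_norm_sub_ne hY
    rw [ae_iff] at h
    refine measure_mono_null ?_ h
    intro X hX hX'
    refine hX' k j hkj ?_
    exact le_antisymm (hUle k X hX.1.1 j) (hUle j X hX.2.1 k)
  · exact fun k => (hU k).inter hBm.nullMeasurableSet

end DistTransform

/-! ### Annular sectors and the law of the gradient on the truncated set. -/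

namespace DistTransform

open scoped Real ENNReal

variable {K : ℕ}

theorem ae_hasGradientAt_S (hK : 0 < K) {Y : Fin K → Plane} (hY : Function.Injective Y) :
    ∀ᵐ X, HasGradientAt (S Y) (gradient (S Y) X) X ∧ ‖gradient (S Y) X‖ = 1 := by
  filter_upwards [ae_mem_openCell hY] with X h
  obtain ⟨k, hk⟩ := exists_nearest hK Y X
  have hg := hasGradientAt_S ((h k).2 hk) (h k).1
  rw [hg.gradient]
  exact ⟨hg, norm_smul_inv_norm (𝕜 := ℝ) (sub_ne_zero.2 (h k).1)⟩

theorem volume_line (v : Plane) : volume (Submodule.span ℝ {v} : Set Plane) = 0 := by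
  refine Measure.addHaar_submodule _ _ fun h => ?_
  have h1 : Module.finrank ℝ (Submodule.span ℝ ({v} : Set Plane)) ≤ 1 :=
    (finrank_span_le_card _).trans (by simp)
  rw [h, finrank_top, finrank_euclideanSpace_fin] at h1
  omega

/-- A gradient equal to `v` forces `X - Y k` into the span of `v` for a nearest centre `Y k`, hence
`X` into one of finitely many null sets. -/
theorem ae_gradient_S_ne (hK : 0 < K) {Y : Fin K → Plane} (hY : Function.Injective Y)
    (v : Plane) : ∀ᵐ X, gradient (S Y) X ≠ v := by
  have h0 : ∀ᵐ X, ∀ k, X - Y k ∉ (Submodule.span ℝ {v} : Set Plane) := by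
    rw [ae_all_iff]
    intro k
    rw [ae_iff]
    simp only [not_not]
    exact ((measurePreserving_sub_right volume (Y k)).measure_preimage
      (Submodule.closed_of_finiteDimensional _).measurableSet.nullMeasurableSet).trans
        (volume_line v)
  filter_upwards [ae_mem_openCell hY, h0] with X h h1 h2
  obtain ⟨k, hk⟩ := exists_nearest hK Y X
  rw [(hasGradientAt_S ((h k).2 hk) (h k).1).gradient] at h2
  refine h1 k (Submodule.mem_span_singleton.2 ⟨‖X - Y k‖, ?_⟩)
  rw [← h2, smul_smul, mul_inv_cancel₀ (norm_ne_zero_iff.2 (sub_ne_zero.2 (h k).1)), one_smul]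

section AnnularSector

variable {δ : ℝ} (a c : ℝ)

theorem mem_polarSet_of_norm_eq_one {U J : Set ℝ} (hU : U ⊆ Set.Ici 0) {x : Plane}
    (hx : x ∈ polarSet U J) (hn : ‖x‖ = 1) : ∃ θ ∈ J, x = dir θ := by
  obtain ⟨r, hr, θ, hθ, rfl⟩ := hx
  rw [norm_smul, norm_dir, mul_one, Real.norm_of_nonneg (hU hr)] at hn
  exact ⟨θ, hθ, by rw [hn, one_smul]⟩

/-- The radius `1` is interior to the radial range, so only the bounding rays of the sector can
contribute points of the unit circle. -/
theorem eq_of_mem_frontier_annularSector (hδ : 0 < δ) (hδ' : δ < 1) (hc : c ≤ π) {x : Plane}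
    (hx : x ∈ frontier (polarSet (Set.Ioo (1 - δ) (1 + δ)) (Set.Ioo a (a + 2 * c))))
    (hn : ‖x‖ = 1) : x = dir a ∨ x = dir (a + 2 * c) := by
  have hopen : IsOpen (polarSet (Set.Ioo (1 - δ) (1 + δ)) (Set.Ioo a (a + 2 * c))) :=
    isOpen_polarSet isOpen_Ioo (fun r hr => by
      have := hr.1
      rw [Set.mem_Ioi]
      linarith) a hc
  have hclosed : IsClosed (polarSet (Set.Icc (1 - δ) (1 + δ)) (Set.Icc a (a + 2 * c))) := by
    have e : polarSet (Set.Icc (1 - δ) (1 + δ)) (Set.Icc a (a + 2 * c)) =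
        (fun p : ℝ × ℝ => p.1 • dir p.2) ''
          (Set.Icc (1 - δ) (1 + δ) ×ˢ Set.Icc a (a + 2 * c)) := by
      ext X
      constructor
      · rintro ⟨r, hr, θ, hθ, rfl⟩
        exact ⟨(r, θ), ⟨hr, hθ⟩, rfl⟩
      · rintro ⟨p, hp, rfl⟩
        exact ⟨p.1, hp.1, p.2, hp.2, rfl⟩
    rw [e]
    exact ((isCompact_Icc.prod isCompact_Icc).image
      (continuous_fst.smul (continuous_dir.comp continuous_snd))).isClosed
  rw [hopen.frontier_eq] at hx
  have hx1 : x ∈ polarSet (Set.Icc (1 - δ) (1 + δ)) (Set.Icc a (a + 2 * c)) := by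
    refine closure_minimal ?_ hclosed hx.1
    rintro _ ⟨r, hr, θ, hθ, rfl⟩
    exact ⟨r, Set.Ioo_subset_Icc_self hr, θ, Set.Ioo_subset_Icc_self hθ, rfl⟩
  obtain ⟨θ, hθ, rfl⟩ := mem_polarSet_of_norm_eq_one (fun r hr => by
      have := hr.1
      rw [Set.mem_Ici]
      linarith) hx1 hn
  rcases hθ.1.eq_or_lt with rfl | h1
  · exact Or.inl rfl
  rcases hθ.2.eq_or_lt with rfl | h2
  · exact Or.inr rfl
  exact absurd ⟨1, ⟨by linarith, by linarith⟩, θ, ⟨h1, h2⟩, (one_smul ℝ _).symm⟩ hx.2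

/-- The radial range contains `1` but not `0`: a normalized nonzero vector is tested only for its
angle, and the origin is excluded. -/
theorem cone_annularSector (hδ : 0 < δ) (hδ' : δ < 1) (J : Set ℝ) :
    cone (polarSet (Set.Ioo (1 - δ) (1 + δ)) J) = polarSet (Set.Ioi 0) J := by
  ext x
  constructor
  · intro hx
    have hpos : ∀ r ∈ Set.Ioo (1 - δ) (1 + δ), 0 < r := fun r hr => by linarith [hr.1]
    have hx0 : x ≠ 0 := by
      rintro rfl
      obtain ⟨r, hr, θ, -, h⟩ := hx
      have := congrArg norm h
      rw [norm_smul r, norm_dir, Real.norm_of_nonneg (hpos r hr).le] at this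
      simp at this
      linarith [hpos r hr]
    obtain ⟨θ, hθ, h⟩ := mem_polarSet_of_norm_eq_one (fun r hr => (hpos r hr).le) hx
      (norm_smul_inv_norm (𝕜 := ℝ) hx0)
    refine ⟨‖x‖, norm_pos_iff.2 hx0, θ, hθ, ?_⟩
    rw [← h]
    exact (smul_inv_smul₀ (norm_ne_zero_iff.2 hx0) x).symm
  · rintro ⟨r, hr, θ, hθ, rfl⟩
    rw [Set.mem_Ioi] at hr
    refine ⟨1, ⟨by linarith, by linarith⟩, θ, hθ, ?_⟩
    rw [norm_smul, norm_dir, mul_one, Real.norm_of_nonneg hr.le, smul_smul,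
      inv_mul_cancel₀ hr.ne']

/-- Integration in polar coordinates over an annular sector. -/
theorem setLIntegral_annularSector {q : Plane → ℝ} (hq : Continuous q) (hq0 : ∀ x, 0 ≤ q x)
    (hδ : 0 < δ) (hδ' : δ < 1) (hc0 : 0 ≤ c) (hc : c ≤ π) :
    ∫⁻ X in polarSet (Set.Ioo (1 - δ) (1 + δ)) (Set.Ioo a (a + 2 * c)), ENNReal.ofReal (q X) =
      ENNReal.ofReal (∫ θ in a..(a + 2 * c), ∫ r in (1 - δ)..(1 + δ), q (r • dir θ) * r) := by
  have hpos : Set.Ioo (1 - δ) (1 + δ) ⊆ Set.Ioi 0 := fun r hr => by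
    have := hr.1
    rw [Set.mem_Ioi]
    linarith
  have hBm : MeasurableSet (polarSet (Set.Ioo (1 - δ) (1 + δ)) (Set.Ioo a (a + 2 * c))) :=
    (isOpen_polarSet isOpen_Ioo hpos a hc).measurableSet
  have hsub : polarSet (Set.Ioo (1 - δ) (1 + δ)) (Set.Ioo a (a + 2 * c)) ⊆
      polarSet (Set.Ioi 0) (Set.Ioo a (a + 2 * c)) := by
    rintro _ ⟨r, hr, θ, hθ, rfl⟩
    exact ⟨r, hpos hr, θ, hθ, rfl⟩
  have hcont : Continuous fun p : ℝ × ℝ => q (p.2 • dir p.1) * p.2 :=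
    (hq.comp (continuous_snd.smul (continuous_dir.comp continuous_fst))).mul continuous_snd
  have hcont2 : Continuous fun θ => ∫ r in (1 - δ)..(1 + δ), q (r • dir θ) * r :=
    intervalIntegral.continuous_parametric_intervalIntegral_of_continuous' hcont _ _
  have hnn : ∀ θ, 0 ≤ ∫ r in (1 - δ)..(1 + δ), q (r • dir θ) * r := fun θ => by
    refine intervalIntegral.integral_nonneg (by linarith) fun r hr => ?_
    exact mul_nonneg (hq0 _) (by linarith [hr.1])
  rw [← Set.inter_eq_left.2 hsub, ← setLIntegral_indicator hBm,
    setLIntegral_sector ((hq.measurable.ennreal_ofReal).indicator hBm) a hc,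
    intervalIntegral.integral_of_le (by linarith), integral_Ioc_eq_integral_Ioo,
    ofReal_integral_eq_lintegral_ofReal
      (hcont2.integrableOn_Icc.mono_set Set.Ioo_subset_Icc_self) (ae_of_all _ hnn)]
  refine setLIntegral_congr_fun measurableSet_Ioo fun θ hθ => ?_
  have hcθ : Continuous fun r : ℝ => q (r • dir θ) * r := hcont.comp (by fun_prop :
    Continuous fun r : ℝ => (θ, r))
  rw [intervalIntegral.integral_of_le (by linarith), integral_Ioc_eq_integral_Ioo,
    ofReal_integral_eq_lintegral_ofReal
      (hcθ.integrableOn_Icc.mono_set Set.Ioo_subset_Icc_self)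
      ((ae_restrict_iff' measurableSet_Ioo).2 (ae_of_all _ fun r hr =>
        mul_nonneg (hq0 _) (le_of_lt (hpos hr)))),
    ← Set.inter_eq_left.2 hpos, ← setLIntegral_indicator measurableSet_Ioo]
  refine setLIntegral_congr_fun measurableSet_Ioi fun r hr => ?_
  rw [Set.mem_Ioi] at hr
  simp only [Set.inter_eq_left.2 hpos]
  by_cases h : r ∈ Set.Ioo (1 - δ) (1 + δ)
  · have hB : r • dir θ ∈ polarSet (Set.Ioo (1 - δ) (1 + δ)) (Set.Ioo a (a + 2 * c)) :=
      ⟨r, h, θ, hθ, rfl⟩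
    rw [Set.indicator_of_mem h, Set.indicator_of_mem hB, ENNReal.ofReal_mul (hq0 _), mul_comm]
  · have hB : r • dir θ ∉ polarSet (Set.Ioo (1 - δ) (1 + δ)) (Set.Ioo a (a + 2 * c)) := by
      rintro ⟨r', hr', θ', -, h'⟩
      have h2 := congrArg norm h'
      rw [norm_smul, norm_smul, norm_dir, norm_dir, mul_one, mul_one, Real.norm_of_nonneg hr.le,
        Real.norm_of_nonneg (le_of_lt (hpos hr'))] at h2
      exact h (h2 ▸ hr')
    rw [Set.indicator_of_notMem h, Set.indicator_of_notMem hB, mul_zero]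

end AnnularSector

section Voronoi

variable {Ω : Set Plane} {Y : Fin K → Plane}

theorem self_mem_cell (hYΩ : ∀ k, Y k ∈ Ω) (k : Fin K) : Y k ∈ cell Ω Y k :=
  ⟨hYΩ k, fun j => by simp⟩

theorem shell_cell_le (hΩ : IsCompact Ω) (hYΩ : ∀ k, Y k ∈ Ω)
    (hcell : ∀ k, StarConvex ℝ (Y k) (cell Ω Y k)) {ε : ℝ} (hε : 0 < ε) (hε' : ε < 1 / 2)
    (k : Fin K) : shell (cell Ω Y k) (Y k) ε ⊆ cell Ω Y k := by
  have hC := isCompact_cell hΩ Y k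
  have hy := self_mem_cell hYΩ k
  refine (shell_subset_shrink hC (hcell k) hy hε hε').trans ?_
  have := shrink_mono hC (hcell k) hy (s := 1 - ε) (t := 1) (by linarith) (by linarith)
  rwa [shrink_one] at this

theorem truncated_eq (Ω : Set Plane) (Y : Fin K → Plane) (ε : ℝ) :
    truncated Ω Y ε = ⋃ k, shell (cell Ω Y k) (Y k) ε := rfl

theorem volume_inter_gradient_mem (hK : 0 < K) (hΩ : IsCompact Ω) (hY : Function.Injective Y)
    {B : Set Plane} (hB : MeasurableSet B) :
    volume (Ω ∩ {X | gradient (S Y) X ∈ B}) =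
      ∑ k, volume (cell Ω Y k ∩ {X | X - Y k ∈ cone B}) := by
  conv_lhs => rw [← iUnion_cell hK Ω Y]
  exact volume_iUnion_inter_gradient_mem hY
    (fun k => (isCompact_cell hΩ Y k).measurableSet.nullMeasurableSet)
    (fun k X hX => hX.2) hB

theorem volume_truncated_inter_gradient_mem (hK : 0 < K) (hΩ : IsCompact Ω)
    (hY : Function.Injective Y) (hYΩ : ∀ k, Y k ∈ Ω)
    (hcell : ∀ k, StarConvex ℝ (Y k) (cell Ω Y k)) {ε : ℝ} (hε : 0 < ε) (hε' : ε < 1 / 2)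
    {B : Set Plane} (hB : MeasurableSet B) :
    volume (truncated Ω Y ε ∩ {X | gradient (S Y) X ∈ B}) =
      ENNReal.ofReal (1 - 2 * ε) * volume (Ω ∩ {X | gradient (S Y) X ∈ B}) := by
  have hC := fun k => isCompact_cell hΩ Y k
  have hy := fun k => self_mem_cell hYΩ k
  rw [volume_inter_gradient_mem hK hΩ hY hB, truncated_eq, Finset.mul_sum,
    volume_iUnion_inter_gradient_mem hY _ _ hB]
  · exact Finset.sum_congr rfl fun k _ => volume_shell_inter_cone (hC k) (hcell k) (hy k) hε hε'
      (measurableSet_cone hB) (smul_mem_cone_iff B)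
  · intro k
    exact ((isCompact_shrink (hC k) _ _).measurableSet.diff
      (isCompact_shrink (hC k) _ _).measurableSet).nullMeasurableSet.congr
        (shell_ae_eq (hC k) (hcell k) (hy k) hε hε').symm
  · exact fun k X hX => (shell_cell_le hΩ hYΩ hcell hε hε' k hX).2

theorem interior_truncated_ae_eq (hΩ : IsCompact Ω) (hfr : volume (frontier Ω) = 0)
    (hY : Function.Injective Y) (hYΩ : ∀ k, Y k ∈ Ω)
    (hcell : ∀ k, StarConvex ℝ (Y k) (cell Ω Y k)) {ε : ℝ} (hε : 0 < ε) (hε' : ε < 1 / 2) :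
    (interior (truncated Ω Y ε) : Set Plane) =ᵐ[volume] truncated Ω Y ε := by
  refine ae_eq_set.2 ⟨?_, ?_⟩
  · rw [Set.sdiff_eq_empty.2 interior_subset, measure_empty]
  · have hsub : truncated Ω Y ε \ interior (truncated Ω Y ε) ⊆
        ⋃ k, shell (cell Ω Y k) (Y k) ε \ interior (shell (cell Ω Y k) (Y k) ε) := by
      rw [truncated_eq]
      rintro X ⟨h1, h2⟩
      obtain ⟨k, hk⟩ := Set.mem_iUnion.1 h1
      exact Set.mem_iUnion.2 ⟨k, hk, fun h => h2 (interior_mono (Set.subset_iUnion _ k) h)⟩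
    exact measure_mono_null hsub (measure_iUnion_null fun k =>
      volume_shell_diff_interior (isCompact_cell hΩ Y k) (hcell k) (self_mem_cell hYΩ k) hε hε'
        (volume_frontier_cell hfr hY k))

/-- The gradient of `S` is distributed on `Ω^ε` as it is on `Ω`. -/
theorem gradientLaw_interior_truncated (hK : 0 < K) (hΩ : IsCompact Ω)
    (hfr : volume (frontier Ω) = 0) (hY : Function.Injective Y) (hYΩ : ∀ k, Y k ∈ Ω)
    (hcell : ∀ k, StarConvex ℝ (Y k) (cell Ω Y k)) {ε : ℝ} (hε : 0 < ε) (hε' : ε < 1 / 2)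
    {B : Set Plane} (hB : MeasurableSet B) :
    gradientLaw (interior (truncated Ω Y ε)) (S Y) B =
      (volume Ω)⁻¹ * volume (Ω ∩ {X | gradient (S Y) X ∈ B}) := by
  have hae := interior_truncated_ae_eq hΩ hfr hY hYΩ hcell hε hε'
  have hvol : volume (truncated Ω Y ε) = ENNReal.ofReal (1 - 2 * ε) * volume Ω := by
    simpa using volume_truncated_inter_gradient_mem hK hΩ hY hYΩ hcell hε hε' MeasurableSet.univ
  have hne : ENNReal.ofReal (1 - 2 * ε) ≠ 0 := by
    rw [Ne, ENNReal.ofReal_eq_zero]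
    linarith
  have hint : volume (interior (truncated Ω Y ε) ∩ {X | gradient (S Y) X ∈ B}) =
      volume (truncated Ω Y ε ∩ {X | gradient (S Y) X ∈ B}) :=
    measure_congr (hae.inter (ae_eq_refl _))
  rw [gradientLaw, Measure.map_apply (measurable_gradient _) hB,
    ProbabilityTheory.cond_apply isOpen_interior.measurableSet]
  change _ * volume (interior (truncated Ω Y ε) ∩ {X | gradient (S Y) X ∈ B}) = _
  rw [hint, measure_congr hae, volume_truncated_inter_gradient_mem hK hΩ hY hYΩ hcell hε hε' hB,
    hvol, ENNReal.mul_inv (Or.inl hne) (Or.inl ENNReal.ofReal_ne_top), mul_mul_mul_comm,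
    ENNReal.inv_mul_cancel hne ENNReal.ofReal_ne_top, one_mul]

theorem gradientLaw_frontier_annularSector (hK : 0 < K) (hY : Function.Injective Y)
    (A : Set Plane) {δ : ℝ} (hδ : 0 < δ) (hδ' : δ < 1) (a : ℝ) {c : ℝ} (hc : c ≤ π) :
    gradientLaw A (S Y)
      (frontier (polarSet (Set.Ioo (1 - δ) (1 + δ)) (Set.Ioo a (a + 2 * c)))) = 0 := by
  rw [gradientLaw, Measure.map_apply (measurable_gradient _) isClosed_frontier.measurableSet]
  refine ProbabilityTheory.cond_absolutelyContinuous ?_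
  have h : ∀ᵐ X, ¬ gradient (S Y) X ∈
      frontier (polarSet (Set.Ioo (1 - δ) (1 + δ)) (Set.Ioo a (a + 2 * c))) := by
    filter_upwards [ae_hasGradientAt_S hK hY, ae_gradient_S_ne hK hY (dir a),
      ae_gradient_S_ne hK hY (dir (a + 2 * c))] with X h1 h2 h3 h4
    exact (eq_of_mem_frontier_annularSector a c hδ hδ' hc h4 h1.2).elim h2 h3
  simp only [ae_iff, not_not] at h
  exact h

end Voronoi

end DistTransform

/-! ### The density `P`, the spectrum `F` and the conclusion. -/

namespace DistTransform

open scoped Real ENNReal FourierTransform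

variable {K : ℕ} {Ω : Set Plane} {Y : Fin K → Plane}

theorem lintegral_radial_sq_ne_top (hΩ : IsCompact Ω) (hYΩ : ∀ k, Y k ∈ Ω)
    (hcell : ∀ k, StarConvex ℝ (Y k) (cell Ω Y k)) (a : ℝ) {c : ℝ} (hc : c ≤ π) (k : Fin K) :
    ∫⁻ θ in Set.Ioo a (a + 2 * c), ENNReal.ofReal (radial (cell Ω Y k) (Y k) θ ^ 2 / 2) ≠ ⊤ := by
  have hC := isCompact_cell hΩ Y k
  rw [← volume_inter_sector hC (hcell k) (self_mem_cell hYΩ k) a hc]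
  exact measure_ne_top_of_subset Set.inter_subset_left hC.measure_lt_top.ne

theorem integrableOn_R_sq (hΩ : IsCompact Ω) (hYΩ : ∀ k, Y k ∈ Ω)
    (hcell : ∀ k, StarConvex ℝ (Y k) (cell Ω Y k)) (a : ℝ) {c : ℝ} (hc : c ≤ π) (k : Fin K) :
    IntegrableOn (fun θ => R Ω Y k θ ^ 2 / 2) (Set.Ioo a (a + 2 * c)) := by
  have hC := isCompact_cell hΩ Y k
  have hm : Measurable (R Ω Y k) := measurable_radial hC (hcell k) (self_mem_cell hYΩ k)
  rw [IntegrableOn, ← lintegral_ofReal_ne_top_iff_integrable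
    (by fun_prop) (ae_of_all _ fun θ => by positivity)]
  exact lintegral_radial_sq_ne_top hΩ hYΩ hcell a hc k

theorem intervalIntegrable_P (hΩ : IsCompact Ω) (hYΩ : ∀ k, Y k ∈ Ω)
    (hcell : ∀ k, StarConvex ℝ (Y k) (cell Ω Y k)) (a : ℝ) {c : ℝ} (hc0 : 0 ≤ c) (hc : c ≤ π) :
    IntervalIntegrable (P Ω Y) volume a (a + 2 * c) := by
  rw [intervalIntegrable_iff_integrableOn_Ioo_of_le (by linarith)]
  exact (integrable_finsetSum _ fun k _ => integrableOn_R_sq hΩ hYΩ hcell a hc k).const_mul _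

/-- The integral of `P` is the proportion of `Ω` on which the gradient of `S` lies in the sector. -/
theorem ofReal_integral_P (hK : 0 < K) (hΩ : IsCompact Ω) (hint : (interior Ω).Nonempty)
    (hY : Function.Injective Y) (hYΩ : ∀ k, Y k ∈ Ω)
    (hcell : ∀ k, StarConvex ℝ (Y k) (cell Ω Y k)) {δ : ℝ} (hδ : 0 < δ) (hδ' : δ < 1) (a : ℝ)
    {c : ℝ} (hc0 : 0 ≤ c) (hc : c ≤ π) :
    ENNReal.ofReal (∫ ω in a..(a + 2 * c), P Ω Y ω) =
      (volume Ω)⁻¹ * volume (Ω ∩ {X | gradient (S Y) X ∈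
        polarSet (Set.Ioo (1 - δ) (1 + δ)) (Set.Ioo a (a + 2 * c))}) := by
  have hpos : 0 < volume.real Ω := by
    refine ENNReal.toReal_pos (fun h => ?_) hΩ.measure_lt_top.ne
    exact (Measure.measure_pos_of_nonempty_interior volume hint).ne' h
  have hB : IsOpen (polarSet (Set.Ioo (1 - δ) (1 + δ)) (Set.Ioo a (a + 2 * c))) :=
    isOpen_polarSet isOpen_Ioo (fun r hr => by
      have := hr.1
      rw [Set.mem_Ioi]
      linarith) a hc
  rw [volume_inter_gradient_mem hK hΩ hY hB.measurableSet, cone_annularSector hδ hδ']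
  simp only [volume_inter_sector (isCompact_cell hΩ Y _) (hcell _) (self_mem_cell hYΩ _) a hc]
  rw [intervalIntegral.integral_of_le (by linarith), integral_Ioc_eq_integral_Ioo]
  simp only [P]
  rw [integral_const_mul, integral_finsetSum _ fun k _ => integrableOn_R_sq hΩ hYΩ hcell a hc k,
    ENNReal.ofReal_mul (by positivity), ENNReal.ofReal_sum_of_nonneg]
  · congr 1
    · rw [one_div, ENNReal.ofReal_inv_of_pos hpos, Measure.real,
        ENNReal.ofReal_toReal hΩ.measure_lt_top.ne]
    · refine Finset.sum_congr rfl fun k _ => ?_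
      rw [ofReal_integral_eq_lintegral_ofReal (integrableOn_R_sq hΩ hYΩ hcell a hc k)
        (ae_of_all _ fun θ => by positivity)]
      rfl
  · exact fun k _ => integral_nonneg fun θ => by positivity

/-- Closed and open angular intervals differ only in the two end directions, each taken by the
gradient on a null set. -/
theorem volume_gradient_dir (hK : 0 < K) (hY : Function.Injective Y) {δ : ℝ} (hδ : 0 < δ)
    (hδ' : δ < 1) (a c : ℝ) :
    volume {X | X ∈ Ω ∧ ∃ θ ∈ Set.Icc a (a + 2 * c), HasGradientAt (S Y) (dir θ) X} =
      volume (Ω ∩ {X | gradient (S Y) X ∈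
        polarSet (Set.Ioo (1 - δ) (1 + δ)) (Set.Ioo a (a + 2 * c))}) := by
  refine measure_congr ?_
  filter_upwards [ae_hasGradientAt_S hK hY, ae_gradient_S_ne hK hY (dir a),
      ae_gradient_S_ne hK hY (dir (a + 2 * c))] with X h1 h2 h3
  refine propext ⟨?_, ?_⟩
  · rintro ⟨hX, θ, hθ, h⟩
    rw [h.gradient] at h2 h3
    refine ⟨hX, ?_⟩
    rw [Set.mem_ofPred_eq, h.gradient]
    refine ⟨1, ⟨by linarith, by linarith⟩, θ, ⟨hθ.1.lt_of_ne ?_, hθ.2.lt_of_ne ?_⟩,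
      (one_smul ℝ _).symm⟩
    · rintro rfl
      exact h2 rfl
    · rintro rfl
      exact h3 rfl
  · rintro ⟨hX, h⟩
    obtain ⟨θ, hθ, h4⟩ := mem_polarSet_of_norm_eq_one (fun r hr => by
      have := hr.1
      rw [Set.mem_Ici]
      linarith) h h1.2
    exact ⟨hX, θ, Set.Ioo_subset_Icc_self hθ, h4 ▸ h1.1⟩

/-- `F` is the Fourier transform of the wave function on the interior of `Ω^ε`. -/
theorem F_eq_fourier {ε : ℝ}
    (hae : (interior (truncated Ω Y ε) : Set Plane) =ᵐ[volume] truncated Ω Y ε) (τ : ℝ)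
    (x : Plane) :
    F Ω Y ε τ (x 0) (x 1) =
      ((1 / (2 * π * τ * √(volume.real (interior (truncated Ω Y ε)))) : ℝ) : ℂ) *
        𝓕 (wave (interior (truncated Ω Y ε)) (S Y) τ) ((2 * π * τ)⁻¹ • x) := by
  rw [F, measureReal_congr hae, ← setIntegral_congr_set hae,
    ← integral_indicator isOpen_interior.measurableSet, Real.fourier_eq]
  congr 1
  refine integral_congr_ae (ae_of_all _ fun X => ?_)
  simp only [wave]
  by_cases hX : X ∈ interior (truncated Ω Y ε)
  · rw [Set.indicator_of_mem hX, Set.indicator_of_mem hX, Circle.smul_def, Real.fourierChar_apply,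
      smul_eq_mul, mul_comm]
    congr 2
    rw [inner_smul_right, EuclideanSpace.inner_eq_star_dotProduct]
    simp only [dotProduct, Fin.sum_univ_two, star_trivial]
    have hπ : (2 * π : ℝ) * (2 * π * τ)⁻¹ = τ⁻¹ := by
      rw [mul_inv (2 * π) τ, mul_inv_cancel_left₀ Real.two_pi_pos.ne']
    rw [mul_neg, ← mul_assoc, hπ]
    push_cast
    ring
  · rw [Set.indicator_of_notMem hX, Set.indicator_of_notMem hX, smul_zero]

theorem spectralMeasure_annularSector {ε : ℝ}
    (hae : (interior (truncated Ω Y ε) : Set Plane) =ᵐ[volume] truncated Ω Y ε)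
    (hfin : volume (interior (truncated Ω Y ε)) ≠ ⊤) {δ : ℝ}
    (hδ : 0 < δ) (hδ' : δ < 1) (a : ℝ) {c : ℝ} (hc0 : 0 ≤ c) (hc : c ≤ π) (τ : ℝ) :
    spectralMeasure (interior (truncated Ω Y ε)) (S Y) τ
        (polarSet (Set.Ioo (1 - δ) (1 + δ)) (Set.Ioo a (a + 2 * c))) =
      ENNReal.ofReal (∫ ω in a..(a + 2 * c), ∫ r in (1 - δ)..(1 + δ),
        powerSpectrum Ω Y ε τ r ω * r) := by
  have hB : IsOpen (polarSet (Set.Ioo (1 - δ) (1 + δ)) (Set.Ioo a (a + 2 * c))) :=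
    isOpen_polarSet isOpen_Ioo (fun r hr => by
      have := hr.1
      rw [Set.mem_Ioi]
      linarith) a hc
  have hcont : Continuous (𝓕 (wave (interior (truncated Ω Y ε)) (S Y) τ)) :=
    VectorFourier.fourierIntegral_continuous Real.continuous_fourierChar
      (by exact continuous_inner) (integrable_wave isOpen_interior.measurableSet hfin
        (measurable_S Y) τ)
  rw [spectralMeasure, withDensity_apply _ hB.measurableSet,
    setLIntegral_annularSector a c (by fun_prop) (fun x => by positivity) hδ hδ' hc0 hc]
  congr! 5 with θ r
  have h := F_eq_fourier hae τ (r • dir θ)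
  simp only [PiLp.smul_apply, smul_eq_mul, dir_apply_zero, dir_apply_one] at h
  -- Squaring the prefactor of `F` gives `1 / ((2πτ)² · area)`, the normalization of
  -- `spectralMeasure` in dimension two.
  rw [powerSpectrum, h, norm_mul, mul_pow, Complex.norm_real, finrank_euclideanSpace_fin]
  rw [Real.norm_eq_abs, sq_abs, sq_abs, one_div, inv_pow,
    mul_pow _ (√_), Real.sq_sqrt measureReal_nonneg]
  ring

end DistTransform

open DistTransform

theorem theorem2 {K : ℕ} (hK : 0 < K)
    (Ω : Set DistTransform.Plane) (hΩ : IsCompact Ω) (hint : (interior Ω).Nonempty)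
    (hpoly : DistTransform.HasPolygonalBoundary Ω)
    (Y : Fin K → DistTransform.Plane) (hY : Function.Injective Y) (hYΩ : ∀ k, Y k ∈ Ω)
    -- each cell is described in polar coordinates around its centre by `0 ≤ r ≤ R_k(θ)`
    (hcell : ∀ k, StarConvex ℝ (Y k) (DistTransform.cell Ω Y k))
    (ε δ ω₀ Δ : ℝ) (hε : 0 < ε) (hε' : ε < 1 / 2) (hδ : 0 < δ) (hδ' : δ < 1)
    (hΔ : 0 < Δ) (hΔ' : Δ < 2 * Real.pi) :
    -- `P` is the density of the gradient orientations of the distance transform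
    (IntervalIntegrable (DistTransform.P Ω Y) volume ω₀ (ω₀ + Δ) ∧
      DistTransform.orientationProb Ω Y ω₀ (ω₀ + Δ) =
        ∫ ω in ω₀..(ω₀ + Δ), DistTransform.P Ω Y ω) ∧
    Tendsto
      (fun τ : ℝ => ∫ ω in ω₀..(ω₀ + Δ), ∫ r in (1 - δ)..(1 + δ),
        DistTransform.powerSpectrum Ω Y ε τ r ω * r)
      (𝓝[≠] 0)
      (𝓝 (∫ ω in ω₀..(ω₀ + Δ), DistTransform.P Ω Y ω)) := by
  -- The sector lemmas are stated with the half-angle `c`, and `Δ < 2π` gives `c ≤ π`.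
  obtain ⟨c, rfl⟩ : ∃ c, Δ = 2 * c := ⟨Δ / 2, by ring⟩
  have hc0 : 0 ≤ c := by linarith
  have hc : c ≤ Real.pi := by linarith
  have hfr := hpoly.volume_frontier
  have hΩfin : volume Ω ≠ ⊤ := hΩ.measure_lt_top.ne
  have hΩpos : volume Ω ≠ 0 := (Measure.measure_pos_of_nonempty_interior volume hint).ne'
  have hP := ofReal_integral_P hK hΩ hint hY hYΩ hcell hδ hδ' ω₀ hc0 hc
  have hP0 : 0 ≤ ∫ ω in ω₀..(ω₀ + 2 * c), DistTransform.P Ω Y ω := by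
    refine intervalIntegral.integral_nonneg (by linarith) fun ω _ => ?_
    unfold DistTransform.P
    positivity
  refine ⟨⟨intervalIntegrable_P hΩ hYΩ hcell ω₀ hc0 hc, ?_⟩, ?_⟩
  · rw [← ENNReal.toReal_ofReal hP0, hP, orientationProb, Measure.real, Measure.real,
      volume_gradient_dir hK hY hδ hδ', ENNReal.toReal_mul, ENNReal.toReal_inv, one_div]
  have hae := interior_truncated_ae_eq hΩ hfr hY hYΩ hcell hε hε'
  have hvol : volume (interior (truncated Ω Y ε)) = ENNReal.ofReal (1 - 2 * ε) * volume Ω := by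
    rw [measure_congr hae]
    simpa using volume_truncated_inter_gradient_mem hK hΩ hY hYΩ hcell hε hε' MeasurableSet.univ
  have hAfin : volume (interior (truncated Ω Y ε)) ≠ ⊤ := by
    rw [hvol]
    exact ENNReal.mul_ne_top ENNReal.ofReal_ne_top hΩfin
  have hApos : volume (interior (truncated Ω Y ε)) ≠ 0 := by
    rw [hvol]
    refine mul_ne_zero ?_ hΩpos
    rw [Ne, ENNReal.ofReal_eq_zero]
    linarith
  have hB : IsOpen (polarSet (Set.Ioo (1 - δ) (1 + δ)) (Set.Ioo ω₀ (ω₀ + 2 * c))) :=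
    isOpen_polarSet isOpen_Ioo (fun r hr => by
      have := hr.1
      rw [Set.mem_Ioi]
      linarith) ω₀ hc
  have key := tendsto_spectralMeasure isOpen_interior hAfin hApos (measurable_S Y)
    ((ae_differentiableAt_S hK hY).mono fun X h _ => h)
    (gradientLaw_frontier_annularSector hK hY _ hδ hδ' ω₀ hc)
  rw [gradientLaw_interior_truncated hK hΩ hfr hY hYΩ hcell hε hε' hB.measurableSet, ← hP] at key
  have key2 := (ENNReal.tendsto_toReal ENNReal.ofReal_ne_top).comp key
  rw [ENNReal.toReal_ofReal hP0] at key2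
  refine key2.congr fun τ => ?_
  rw [Function.comp_apply, spectralMeasure_annularSector hae hAfin hδ hδ' ω₀ hc0 hc,
    ENNReal.toReal_ofReal]
  refine intervalIntegral.integral_nonneg (by linarith) fun ω _ =>
    intervalIntegral.integral_nonneg (by linarith) fun r hr => ?_
  exact mul_nonneg (sq_nonneg _) (by linarith [hr.1])
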